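/- Let $d\ge 2$, and let the collision kernel be $B(u,\sigma)=|u|^\beta\,h(\cos\theta)$, $\cos\theta=\frac{u\cdot\sigma}{|u|}$, for $u\in\mathbb R^d$, $\sigma\in S^{d-1}$, where $0<\beta\le 1$, $h\ge 0$ is a measurable function on $(-1,1)$ such that $h(z)+h(-z)$ is nondecreasing on $(0,1)$, and $h(\cos\theta)\sin^\alpha\theta\le C_h$ for all $\theta\in(0,\pi)$, with constants $\alpha<d-1$ and $C_h$. Put $$Q(g)(v)=\int_{\mathbb R^d}\int_{S^{d-1}}\bigl(g(v'_*)\,g(v')-g(v_*)\,g(v)\bigr)\,B(v-v_*,\sigma)\,d\sigma\,dv_*,$$ where $v'=\frac{v+v_*}2+\frac{|v-v_*|}2\sigma$ and $v'_*=\frac{v+v_*}2-\frac{|v-v_*|}2\sigma$. Let $f_0\ge 0$ be such that $f_0/M_0\in L^1(\mathbb R^d)$ for some $M_0(v)=e^{-a_0|v|^2}$, $a_0>0$. Let $f(v,t)$, $v\in\mathbb R^d$, $t\ge 0$, be a mild solution of the spatially homogeneous Boltzmann equation $\partial_t f=Q(f)$, $f|_{t=0}=f_0$, that is, $0\le f\in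 C([0,\infty);L^1(\mathbb R^d))$, $(1+|v|^2)f\in L^\infty((0,\infty);L^1(\mathbb R^d))$, and for almost every $v$ one has $f(v,0)=f_0(v)$ and $f(v,t)-f(v,s)=\int_s^t Q(f)(v,\tau)\,d\tau$ for all $0\le s<t$. Assume that $f$ conserves mass and energy: for all $t\ge 0$, $$\int_{\mathbb R^d} f(v,t)\,dv=\int_{\mathbb R^d} f_0(v)\,dv,\qquad \int_{\mathbb R^d} f(v,t)\,|v|^2\,dv=\int_{\mathbb R^d} f_0(v)\,|v|^2\,dv.$$ Then there exist constants $C$ and $a>0$ such that, with $M(v)=e^{-a|v|^2}$, $$\int_{\mathbb R^d}\frac{f(v,t)}{M(v)}\,dv\le C\qquad\text{for all } t\ge 0.$$ -/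

import Mathlib

open MeasureTheory Set Filter Topology

noncomputable section

namespace Boltzmann

/-- Velocity space: `d`-dimensional Euclidean space. -/
abbrev V (d : ℕ) : Type := EuclideanSpace ℝ (Fin d)

/-- The unit sphere `S^{d-1}` of the velocity space. -/
abbrev S (d : ℕ) : Type := Metric.sphere (0 : V d) 1

/-- The surface measure `dσ` on the unit sphere. -/
def surface (d : ℕ) : Measure (S d) := (volume : Measure (V d)).toSphere

/-- The transformed velocity `v' = (v + v_*)/2 + (|v - v_*|/2) σ`. -/
def vPrime {d : ℕ} (v w : V d) (σ : S d) : V d :=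
  (1 / 2 : ℝ) • (v + w) + (‖v - w‖ / 2) • (σ : V d)

/-- The transformed velocity `v'_* = (v + v_*)/2 - (|v - v_*|/2) σ`. -/
def vPrimeStar {d : ℕ} (v w : V d) (σ : S d) : V d :=
  (1 / 2 : ℝ) • (v + w) - (‖v - w‖ / 2) • (σ : V d)

/-- The collision kernel `B(u, σ) = |u|^β h(cos θ)` with `cos θ = (u · σ) / |u|`. -/
def kernel {d : ℕ} (β : ℝ) (h : ℝ → ℝ) (u : V d) (σ : S d) : ℝ :=
  ‖u‖ ^ β * h (inner ℝ u (σ : V d) / ‖u‖)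

/-- The Boltzmann collision operator
`Q(g)(v) = ∫ ∫ (g(v'_*) g(v') - g(v_*) g(v)) B(v - v_*, σ) dσ dv_*`. -/
def collision {d : ℕ} (B : V d → S d → ℝ) (g : V d → ℝ) (v : V d) : ℝ :=
  ∫ w : V d, ∫ σ : S d,
    (g (vPrimeStar v w σ) * g (vPrime v w σ) - g w * g v) * B (v - w) σ ∂(surface d)

/-- Hard potentials with angular cutoff: `0 < β ≤ 1`, and the angular function `h` is measurable,
nonnegative on `(-1, 1)`, has a symmetrization that is nondecreasing on `(0, 1)`, and satisfies
`h(cos θ) sin^α θ ≤ C` on `(0, π)` for some `α < d - 1` and some constant `C`.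
Only the values of `h` on `(-1, 1)` matter. -/
structure IsHardPotentialCutoff (d : ℕ) (β : ℝ) (h : ℝ → ℝ) : Prop where
  beta_pos : 0 < β
  beta_le_one : β ≤ 1
  measurable : Measurable h
  nonneg : ∀ z ∈ Ioo (-1 : ℝ) 1, 0 ≤ h z
  monotone_symm : MonotoneOn (fun z => h z + h (-z)) (Ioo 0 1)
  cutoff : ∃ α : ℝ, α < (d : ℝ) - 1 ∧
    ∃ C : ℝ, ∀ θ ∈ Ioo (0 : ℝ) Real.pi, h (Real.cos θ) * Real.sin θ ^ α ≤ C

/-- Nonnegative mild solutions `f(v, t)`, `t ≥ 0`, of `∂_t f = Q(f)`, `f|_{t = 0} = f₀`: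
`f ∈ C([0,∞); L¹)`, `(1 + |v|²) f ∈ L^∞((0,∞); L¹)`, and for almost every `v` the equation holds
in integrated form between all times `0 ≤ s < t`. -/
structure IsMildSolution {d : ℕ} (B : V d → S d → ℝ) (f₀ : V d → ℝ) (f : V d → ℝ → ℝ) :
    Prop where
  measurable : Measurable (fun p : V d × ℝ => f p.1 p.2)
  nonneg : ∀ t, 0 ≤ t → ∀ᵐ v, 0 ≤ f v t
  integrable : ∀ t, 0 ≤ t → Integrable (fun v => f v t)
  continuous_L1 : ∀ t, 0 ≤ t →
    Tendsto (fun s => ∫ v, |f v s - f v t|) (𝓝[Ici 0] t) (𝓝 0)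
  bounded : ∃ K : ℝ, ∀ᵐ t ∂(volume.restrict (Ioi (0 : ℝ))),
    Integrable (fun v => (1 + ‖v‖ ^ 2) * f v t) ∧ ∫ v, (1 + ‖v‖ ^ 2) * f v t ≤ K
  mild : ∀ᵐ v, f v 0 = f₀ v ∧ ∀ s t, 0 ≤ s → s < t →
    IntervalIntegrable (fun τ => collision B (fun w => f w τ) v) volume s t ∧
    f v t - f v s = ∫ τ in s..t, collision B (fun w => f w τ) v

/-- Conservation of mass and energy: the two integrals are finite at all times and equal to those
of the initial datum. -/
structure ConservesMassEnergy {d : ℕ} (f₀ : V d → ℝ) (f : V d → ℝ → ℝ) : Prop where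
  mass : ∀ t, 0 ≤ t → Integrable (fun v => f v t) ∧ ∫ v, f v t = ∫ v, f₀ v
  energy : ∀ t, 0 ≤ t → Integrable (fun v => f v t * ‖v‖ ^ 2) ∧
    ∫ v, f v t * ‖v‖ ^ 2 = ∫ v, f₀ v * ‖v‖ ^ 2

/-- The Maxwellian `M(v) = e^{-a|v|²}`. -/
def maxwellian {d : ℕ} (a : ℝ) (v : V d) : ℝ := Real.exp (-a * ‖v‖ ^ 2)

end Boltzmann

end

/-! The Gaussian moment is controlled through truncations. Let ψ_n(v) be `expTaylor n (a * ‖v‖ ^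
2)`, let F, J and m_β be the integrals of f ψ_n, f |v|^β ψ_n and f |v|^β, and let m₀, m₁ be the mass
and the energy. For one small a, independent of n and t, F ≤ m₀ at all times as soon as n is large;
Fatou as n → ∞ (`fatou_bound`) then bounds ∫ f e^{a|v|²} by 2m₀.

By the weak form (`weak_form`, `IsMildSolution.integral_sub_eq`) the time derivative of F is half
the integral of f f_* against the angular average of ψ_n(v') + ψ_n(v'_*) − ψ_n(v) − ψ_n(v_*). This
rests on microreversibility: in the variables (v + v_*)/2, u = v − v_*, y = |u|σ the collision
exchanges u and y, and the law of (u, y) is symmetric.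

The gain obeys a Povzner inequality (`exists_povzner_bound`). With E = |v|² + |v_*|², the energies
after the collision are E(1 ± e·σ)/2 with |e| ≤ 1. Terms of degree k thus carry the factor ((1 +
e·σ)/2)^k + ((1 − e·σ)/2)^k, whose angular average is small for large k, uniformly in the velocities
(`IsAngularKernel.exists_average_le`). Low degrees cost only a multiple of E and a small part of a
term of higher degree. With A the total mass of the angular kernel, this and the loss term give F' ≤
L m₀ m₁ + (A/6)(m_β + J)(m₀ + F) − A(J m₀ − F m_β).

While m₀ ≤ F ≤ 2m₀, the gain consumes at most half of the loss A m₀ J. If a is so small that ψ_n ≤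
1/2 on |v| ≤ R, then J ≥ R^β m₀/2, and for R large the other half dominates everything bounded: F
cannot increase in that range. Small a also gives F(0) ≤ m₀, and `barrier` concludes, uniformly in
time.

Testing with ψ_n requires finite polynomial moments, but no uniformity in time.
`exists_moment_bound` obtains them by Gronwall for convex weights of linear growth, which need only
the conserved mass and energy. -/

noncomputable section

namespace Boltzmann

/-! ### Symmetries of the collision measure -/

/-- Polar coordinates as a measure-preserving parametrisation of the whole space. -/
theorem measurePreserving_polar (d : ℕ) (hd : 2 ≤ d) :
    MeasurePreserving (fun p : S d × Ioi (0 : ℝ) => (p.2 : ℝ) • (p.1 : V d))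
      ((surface d).prod (Measure.volumeIoiPow (Module.finrank ℝ (V d) - 1))) volume := by
  have : Nontrivial (V d) := by
    have : Nonempty (Fin d) := ⟨⟨0, by omega⟩⟩
    infer_instance
  have h1 := (Measure.measurePreserving_homeomorphUnitSphereProd (volume : Measure (V d))).symm
    (homeomorphUnitSphereProd (V d)).toMeasurableEquiv
  have h2 : MeasurePreserving (Subtype.val : ({0}ᶜ : Set (V d)) → V d)
      (Measure.comap Subtype.val volume) volume := by
    refine ⟨measurable_subtype_coe, ?_⟩
    rw [map_comap_subtype_coe (measurableSet_singleton _).compl, restrict_compl_singleton]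
  exact h2.comp h1

/-- The law of `(u, |u| σ)` when `u` is distributed by Lebesgue measure and `σ` uniformly. -/
def collisionPairs (d : ℕ) : Measure (V d × V d) :=
  ((volume : Measure (V d)).prod (surface d)).map (fun p => (p.1, ‖p.1‖ • (p.2 : V d)))

instance (d : ℕ) : IsFiniteMeasure (surface d) := by unfold surface; infer_instance

instance (d : ℕ) : SFinite (collisionPairs d) := by unfold collisionPairs; infer_instance

theorem measurable_collisionPair (d : ℕ) :
    Measurable (fun p : V d × S d => (p.1, ‖p.1‖ • (p.2 : V d))) := by fun_prop

theorem measurePreserving_collisionPair (d : ℕ) :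
    MeasurePreserving (fun p : V d × S d => (p.1, ‖p.1‖ • (p.2 : V d)))
      ((volume : Measure (V d)).prod (surface d)) (collisionPairs d) :=
  ⟨measurable_collisionPair d, rfl⟩

/-- If u = rω then |u|σ = rσ: the two vectors share their radius, and their directions are
independent with the same law. This is the source of the symmetry between relative velocities before
and after the collision. -/
theorem measurePreserving_polar_pair (d : ℕ) (hd : 2 ≤ d) :
    MeasurePreserving
      (fun p : (S d × Ioi (0 : ℝ)) × S d =>
        ((p.1.2 : ℝ) • (p.1.1 : V d), (p.1.2 : ℝ) • (p.2 : V d)))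
      (((surface d).prod (Measure.volumeIoiPow (Module.finrank ℝ (V d) - 1))).prod (surface d))
      (collisionPairs d) := by
  have h1 := (measurePreserving_collisionPair d).comp
    ((measurePreserving_polar d hd).prod (MeasurePreserving.id (surface d)))
  convert h1 using 1
  ext1 p
  have : ‖(p.1.2 : ℝ) • (p.1.1 : V d)‖ = (p.1.2 : ℝ) := by
    rw [norm_smul, norm_eq_of_mem_sphere, mul_one, Real.norm_of_nonneg p.1.2.2.out.le]
  simp [Prod.map, norm_smul, abs_of_pos p.1.2.2.out]

/-- Exchanging the relative velocities before and after the collision. -/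
theorem measurePreserving_swap_collisionPairs (d : ℕ) (hd : 2 ≤ d) :
    MeasurePreserving Prod.swap (collisionPairs d) (collisionPairs d) := by
  have h := measurePreserving_polar_pair d hd
  set ρ := Measure.volumeIoiPow (Module.finrank ℝ (V d) - 1)
  have hs : MeasurePreserving (fun p : (S d × Ioi (0 : ℝ)) × S d => ((p.2, p.1.2), p.1.1))
      (((surface d).prod ρ).prod (surface d)) (((surface d).prod ρ).prod (surface d)) := by
    have e1 := measurePreserving_prodAssoc (surface d) ρ (surface d)
    have e2 : MeasurePreserving Prod.swap ((surface d).prod (ρ.prod (surface d)))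
      ((ρ.prod (surface d)).prod (surface d)) := Measure.measurePreserving_swap
    have e3 : MeasurePreserving (Prod.map (Prod.swap : Ioi (0 : ℝ) × S d → _) (id : S d → S d))
      ((ρ.prod (surface d)).prod (surface d)) (((surface d).prod ρ).prod (surface d)) :=
      Measure.measurePreserving_swap.prod (MeasurePreserving.id _)
    exact e3.comp (e2.comp e1)
  have h2 := h.comp hs
  refine ⟨measurable_swap, ?_⟩
  conv_lhs => rw [← h.map_eq]
  rw [Measure.map_map measurable_swap h.measurable, ← h2.map_eq]
  rfl

/-- The map induced on the unit sphere by a linear isometry. -/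
def sphereMap {d : ℕ} (R : V d ≃ₗᵢ[ℝ] V d) (σ : S d) : S d :=
  ⟨R σ, by simp [mem_sphere_iff_norm]⟩

@[simp] theorem coe_sphereMap {d : ℕ} (R : V d ≃ₗᵢ[ℝ] V d) (σ : S d) :
    (sphereMap R σ : V d) = R σ := rfl

theorem measurable_sphereMap {d : ℕ} (R : V d ≃ₗᵢ[ℝ] V d) : Measurable (sphereMap R) := by
  apply Measurable.subtype_mk
  exact R.continuous.measurable.comp measurable_subtype_coe

open scoped Pointwise in
theorem measurePreserving_sphereMap {d : ℕ} (R : V d ≃ₗᵢ[ℝ] V d) :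
    MeasurePreserving (sphereMap R) (surface d) (surface d) := by
  refine ⟨measurable_sphereMap R, ?_⟩
  ext s hs
  rw [Measure.map_apply (measurable_sphereMap R) hs, surface,
    Measure.toSphere_apply' _ hs, Measure.toSphere_apply' _ (measurable_sphereMap R hs)]
  congr 1
  -- The surface measure of `s` is a multiple of the volume of the cone `Ioo 0 1 • s`, so its
  -- invariance is that of Lebesgue measure.
  rw [← R.measurePreserving.measure_preimage_equiv (f := R.toMeasurableEquiv)
    (Ioo (0 : ℝ) 1 • (Subtype.val '' s))]
  congr 1
  ext x
  constructor
  · rintro ⟨r, hr, _, ⟨σ, hσ, rfl⟩, rfl⟩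
    exact ⟨r, hr, _, ⟨sphereMap R σ, hσ, rfl⟩, by simp⟩
  · rintro ⟨r, hr, _, ⟨σ, hσ, rfl⟩, hxy⟩
    have hσ' : sphereMap R (sphereMap R.symm σ) = σ := Subtype.ext (by simp)
    refine ⟨r, hr, _, ⟨sphereMap R.symm σ, by simpa [hσ'] using hσ, rfl⟩, R.injective ?_⟩
    simpa using hxy

theorem measurePreserving_neg_collisionPairs (d : ℕ) :
    MeasurePreserving (fun p : V d × V d => (-p.1, -p.2)) (collisionPairs d)
      (collisionPairs d) := by
  have h := measurePreserving_collisionPair d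
  have h2 := h.comp (((Measure.measurePreserving_neg (volume : Measure (V d)))).prod
    (measurePreserving_sphereMap (LinearIsometryEquiv.neg ℝ (E := V d))))
  refine ⟨by fun_prop, ?_⟩
  conv_lhs => rw [← h.map_eq]
  rw [Measure.map_map (by fun_prop) h.measurable, ← h2.map_eq]
  congr 1
  ext1 p
  simp [Prod.map]

/-- Passing to the mean velocity, the relative velocity and its rotated version. -/
theorem measurePreserving_collisionCoordinates (d : ℕ) :
    MeasurePreserving
      (fun p : (V d × V d) × S d =>
        ((1 / 2 : ℝ) • (p.1.1 + p.1.2), p.1.1 - p.1.2, ‖p.1.1 - p.1.2‖ • (p.2 : V d)))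
      (((volume : Measure (V d)).prod volume).prod (surface d))
      ((volume : Measure (V d)).prod (collisionPairs d)) := by
  have a1 : MeasurePreserving (fun p : V d × V d => (p.1, p.2 - p.1))
      ((volume : Measure (V d)).prod volume) (volume.prod volume) :=
    (MeasurePreserving.id _).skew_product (g := fun w v => v - w) (by fun_prop)
      (.of_forall fun w => (measurePreserving_sub_right volume w).map_eq)
  have a2 : MeasurePreserving (fun p : V d × V d => (p.1, p.2 + (1 / 2 : ℝ) • p.1))
      ((volume : Measure (V d)).prod volume) (volume.prod volume) :=
    (MeasurePreserving.id _).skew_product (g := fun u w => w + (1 / 2 : ℝ) • u) (by fun_prop)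
      (.of_forall fun w => (measurePreserving_add_right volume _).map_eq)
  have sw : MeasurePreserving (Prod.swap : V d × V d → _)
      ((volume : Measure (V d)).prod volume) (volume.prod volume) := Measure.measurePreserving_swap
  have a3 := sw.comp (a2.comp (sw.comp (a1.comp sw)))
  have as := measurePreserving_prodAssoc (volume : Measure (V d)) (volume : Measure (V d)) (surface d)
  have a4 := ((MeasurePreserving.id (volume : Measure (V d))).prod
    (measurePreserving_collisionPair d)).comp
    (as.comp (a3.prod (MeasurePreserving.id (surface d))))
  convert a4 using 1
  ext1 p
  simp only [Function.comp, Prod.map, Prod.swap, id, MeasurableEquiv.prodAssoc, MeasurableEquiv.coe_mk, Equiv.prodAssoc_apply]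
  refine Prod.ext ?_ rfl
  simp only
  module

theorem exists_isometry_map_eq {d : ℕ} {k e : V d} (h : ‖k‖ = ‖e‖) :
    ∃ R : V d ≃ₗᵢ[ℝ] V d, R k = e :=
  ⟨_, Submodule.reflection_sub h⟩

theorem measurable_inner_sphere {d : ℕ} (k : V d) :
    Measurable (fun σ : S d => inner ℝ k (σ : V d)) := by fun_prop

/-- The law of the cosine of the angle with a fixed direction does not depend on the direction. -/
theorem measurePreserving_inner {d : ℕ} {k e : V d} (hk : ‖k‖ = ‖e‖) :
    MeasurePreserving (fun σ : S d => inner ℝ k (σ : V d)) (surface d)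
      ((surface d).map (fun σ : S d => inner ℝ e (σ : V d))) := by
  refine ⟨measurable_inner_sphere k, ?_⟩
  obtain ⟨R, rfl⟩ := exists_isometry_map_eq hk
  conv_lhs => rw [← (measurePreserving_sphereMap R.symm).map_eq]
  rw [Measure.map_map (measurable_inner_sphere k) (measurable_sphereMap _)]
  congr 1
  ext1 σ
  simp only [Function.comp, coe_sphereMap]
  rw [← R.inner_map_map]
  simp

/-! ### Integrability of negative powers of the sine on the sphere -/

theorem ae_coord_ne_zero {d : ℕ} : ∀ᵐ x : V d, ∀ i, x i ≠ 0 := by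
  rw [ae_all_iff]
  intro i
  have h1 : ∀ᵐ x : Fin d → ℝ, x i ≠ 0 := by
    have : ∀ᵐ t : ℝ, t ≠ 0 := by simp [ae_iff, measure_singleton]
    exact (Measure.quasiMeasurePreserving_eval (μ := fun _ : Fin d => (volume : Measure ℝ)) i).ae this
  exact (EuclideanSpace.volume_preserving_symm_measurableEquiv_toLp
    (Fin d)).quasiMeasurePreserving.ae h1

theorem ae_prod_polar {d : ℕ} (hd : 2 ≤ d) {p : V d → Prop} (hp : ∀ᵐ x, p x) :
    ∀ᵐ (r : Ioi (0 : ℝ)) ∂(Measure.volumeIoiPow (Module.finrank ℝ (V d) - 1)),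
      ∀ᵐ (σ : S d) ∂(surface d),
      p ((r : ℝ) • (σ : V d)) := by
  have h := (measurePreserving_polar d hd).comp
    (Measure.measurePreserving_swap (μ := Measure.volumeIoiPow (Module.finrank ℝ (V d) - 1))
      (ν := surface d))
  exact Measure.ae_ae_of_ae_prod (h.quasiMeasurePreserving.ae hp)

theorem volumeIoiPow_Iio_ne_zero (n : ℕ) :
    Measure.volumeIoiPow n (Iio ⟨1, mem_Ioi.2 one_pos⟩) ≠ 0 := by
  rw [Measure.volumeIoiPow_apply_Iio]
  simp only [ne_eq, ENNReal.ofReal_eq_zero, not_le]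
  positivity

theorem exists_radius {n : ℕ} {p : Ioi (0 : ℝ) → Prop}
    (hp : ∀ᵐ r ∂(Measure.volumeIoiPow n), p r) : ∃ r : Ioi (0 : ℝ), (r : ℝ) < 1 ∧ p r := by
  by_contra! h
  refine volumeIoiPow_Iio_ne_zero n (measure_mono_null (fun r hr => ?_) hp)
  exact h r hr

theorem ae_sphere_coord_ne_zero {d : ℕ} (hd : 2 ≤ d) :
    ∀ᵐ (σ : S d) ∂(surface d), ∀ i, (σ : V d) i ≠ 0 := by
  obtain ⟨r, -, hr⟩ := exists_radius (ae_prod_polar hd ae_coord_ne_zero)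
  filter_upwards [hr] with σ hσ i hi
  exact hσ i (by simp [hi])

theorem integrable_indicator_abs_rpow {s : ℝ} (hs : s < 1) :
    Integrable ((Icc (-1 : ℝ) 1).indicator (fun t => |t| ^ (-s))) := by
  rw [integrable_indicator_iff measurableSet_Icc]
  have h1 : IntegrableOn (fun t : ℝ => |t| ^ (-s)) (Ioc 0 1) := by
    have := (intervalIntegral.intervalIntegrable_rpow' (a := 0) (b := 1) (r := -s) (by linarith)).1
    refine this.congr_fun (fun t ht => ?_) measurableSet_Ioc
    simp [abs_of_pos ht.1]
  have h2 : IntegrableOn (fun t : ℝ => |t| ^ (-s)) (Ico (-1) 0) := by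
    have h3 := (h1.integrable_indicator measurableSet_Ioc).comp_neg
    rw [← integrable_indicator_iff measurableSet_Ico]
    refine h3.congr (.of_forall fun t => ?_)
    by_cases ht : t ∈ Ico (-1 : ℝ) 0
    · have : -t ∈ Ioc (0 : ℝ) 1 := ⟨by linarith [ht.2], by linarith [ht.1]⟩
      simp [ht, this]
    · have : -t ∉ Ioc (0 : ℝ) 1 := fun h => ht ⟨by linarith [h.2], by linarith [h.1]⟩
      simp [ht, this]
  have h3 : IntegrableOn (fun t : ℝ => |t| ^ (-s)) {0} := by simp
  refine ((h1.union h2).union h3).mono_set (fun t ht => ?_)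
  rcases lt_trichotomy t 0 with h | h | h
  · exact Or.inl (Or.inr ⟨ht.1, h⟩)
  · exact Or.inr h
  · exact Or.inl (Or.inl ⟨h, ht.2⟩)

theorem sum_coord_sq {d : ℕ} (σ : S d) : ∑ i, (σ : V d) i ^ 2 = 1 := by
  have := EuclideanSpace.norm_sq_eq (σ : V d)
  simpa using this.symm

theorem abs_coord_le_one {d : ℕ} (σ : S d) (i : Fin d) : |(σ : V d) i| ≤ 1 := by
  rw [← sq_le_one_iff_abs_le_one]
  refine le_of_le_of_eq ?_ (sum_coord_sq σ)
  exact Finset.single_le_sum (f := fun i => (σ : V d) i ^ 2) (fun j _ => sq_nonneg _)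
    (Finset.mem_univ i)

theorem sq_coord_le {d : ℕ} (σ : S d) {i j : Fin d} (hij : j ≠ i) :
    (σ : V d) j ^ 2 ≤ 1 - (σ : V d) i ^ 2 := by
  have h := sum_coord_sq σ
  rw [← Finset.add_sum_erase _ _ (Finset.mem_univ i)] at h
  refine le_of_le_of_eq ?_ (eq_sub_of_add_eq' h)
  exact Finset.single_le_sum (f := fun i => (σ : V d) i ^ 2) (fun j _ => sq_nonneg _)
    (Finset.mem_erase.2 ⟨hij, Finset.mem_univ j⟩)

/-- No spherical coordinates are needed. On the cube, the product of |x_j|^{-s} over the d − 1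
indices j ≠ i₀, with s = α/(d − 1) < 1, is integrable by Fubini. On the sphere each |σ_j| with j ≠
i₀ is at most the sine, so this product dominates sin^{-α}. -/
theorem integrable_sin_rpow {d : ℕ} (hd : 2 ≤ d) (i₀ : Fin d) {α : ℝ} (h0 : 0 ≤ α)
    (hα : α < (d : ℝ) - 1) :
    Integrable (fun σ : S d => (1 - (σ : V d) i₀ ^ 2) ^ (-(α / 2))) (surface d) := by
  have hd1 : (0 : ℝ) < (d : ℝ) - 1 := by
    have : (2 : ℝ) ≤ d := by exact_mod_cast hd
    linarith
  set s := α / ((d : ℝ) - 1) with hs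
  have hs1 : s < 1 := by rw [hs, div_lt_one hd1]; exact hα
  have hs0 : 0 ≤ s := by positivity
  set G : ℝ → ℝ := (Icc (-1 : ℝ) 1).indicator (fun t => |t| ^ (-s)) with hG
  set G0 : ℝ → ℝ := (Icc (-1 : ℝ) 1).indicator (fun _ => 1) with hG0
  have hG0i : Integrable G0 := by
    rw [hG0, integrable_indicator_iff measurableSet_Icc]
    simp
  have hF : Integrable (fun x : Fin d → ℝ => ∏ i, (if i = i₀ then G0 else G) (x i)) := by
    refine Integrable.fintype_prod (μ := fun _ : Fin d => (volume : Measure ℝ)) fun i => ?_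
    split_ifs
    · exact hG0i
    · exact integrable_indicator_abs_rpow hs1
  have hF' : Integrable (fun x : V d => ∏ i, (if i = i₀ then G0 else G) (x i)) :=
    ((EuclideanSpace.volume_preserving_symm_measurableEquiv_toLp (Fin d)).integrable_comp_emb
      (MeasurableEquiv.measurableEmbedding _)).2 hF
  have hsw := (measurePreserving_polar d hd).comp
    (Measure.measurePreserving_swap (μ := Measure.volumeIoiPow (Module.finrank ℝ (V d) - 1))
      (ν := surface d))
  have hFp := ((hsw.integrable_comp hF'.aestronglyMeasurable).2 hF').prod_right_ae
  -- Fubini in polar coordinates gives integrability on almost every sphere; one radius suffices,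
  -- and r < 1 keeps that sphere inside the cube.
  obtain ⟨r, hr1, hr⟩ := exists_radius hFp
  refine hr.mono' (by
    apply Measurable.aestronglyMeasurable
    exact ((by fun_prop : Measurable fun σ : S d => 1 - (σ : V d) i₀ ^ 2).pow_const _)) ?_
  filter_upwards [ae_sphere_coord_ne_zero hd] with σ hσ
  have hr0 : (0 : ℝ) < r := r.2
  have hmem : ∀ i, (r : ℝ) * (σ : V d) i ∈ Icc (-1 : ℝ) 1 := by
    intro i
    rw [mem_Icc, ← abs_le, abs_mul, abs_of_pos hr0]
    exact mul_le_one₀ hr1.le (abs_nonneg _) (abs_coord_le_one σ i)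
  obtain ⟨j, hj⟩ : ∃ j, j ≠ i₀ := by
    have : Nontrivial (Fin d) := Fin.nontrivial_iff_two_le.2 hd
    exact exists_ne i₀
  have hq : 0 < 1 - (σ : V d) i₀ ^ 2 :=
    lt_of_lt_of_le (by have := hσ j; positivity) (sq_coord_le σ hj)
  set q := 1 - (σ : V d) i₀ ^ 2
  rw [Real.norm_of_nonneg (by positivity)]
  have e1 : q ^ (-(α / 2)) = ∏ i, if i = i₀ then (1 : ℝ) else q ^ (-(s / 2)) := by
    rw [Finset.prod_ite, Finset.prod_const_one, one_mul, Finset.prod_const, ← Real.rpow_natCast,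
      ← Real.rpow_mul hq.le]
    congr 1
    rw [Finset.filter_ne' , Finset.card_erase_of_mem (Finset.mem_univ _), Finset.card_univ,
      Fintype.card_fin, Nat.cast_sub (by omega), hs]
    field_simp
    simp
  rw [e1]
  refine Finset.prod_le_prod (fun i _ => by split_ifs <;> positivity) (fun i _ => ?_)
  simp only [Function.comp, Prod.swap, PiLp.smul_apply, smul_eq_mul]
  split_ifs with hi
  · simp [hG0, hmem]
  · simp only [hG]
    rw [indicator_of_mem (hmem i)]
    have hpos : 0 < |(r : ℝ) * (σ : V d) i| := abs_pos.2 (mul_ne_zero hr0.ne' (hσ i))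
    have e2 : q ^ (-(s / 2)) = (Real.sqrt q) ^ (-s) := by
      rw [Real.sqrt_eq_rpow, ← Real.rpow_mul hq.le]
      congr 1; ring
    rw [e2]
    refine Real.rpow_le_rpow_of_nonpos hpos ?_ (by linarith)
    apply Real.le_sqrt_of_sq_le
    rw [sq_abs, mul_pow]
    calc (r : ℝ) ^ 2 * (σ : V d) i ^ 2 ≤ 1 * (σ : V d) i ^ 2 := by
          gcongr
          exact pow_le_one₀ hr0.le hr1.le
      _ ≤ q := by rw [one_mul]; exact sq_coord_le σ hi

/-! ### Angular kernels and concentration of angular averages -/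

/-- A nonnegative integrable angular function of total mass `A`. -/
structure IsAngularKernel (d : ℕ) (h : ℝ → ℝ) (A : ℝ) : Prop where
  measurable : Measurable h
  nonneg : ∀ z, 0 ≤ h z
  integrable : ∀ k : V d, ‖k‖ = 1 → Integrable (fun σ : S d => h (inner ℝ k (σ : V d))) (surface d)
  mass : ∀ k : V d, ‖k‖ = 1 → ∫ σ : S d, h (inner ℝ k (σ : V d)) ∂(surface d) = A

theorem ae_inner_mem_Ioo {d : ℕ} (hd : 2 ≤ d) {k : V d} (hk : ‖k‖ = 1) :
    ∀ᵐ (σ : S d) ∂(surface d), inner ℝ k (σ : V d) ∈ Ioo (-1 : ℝ) 1 := by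
  set i₀ : Fin d := ⟨0, by omega⟩
  have he : ‖k‖ = ‖(EuclideanSpace.single i₀ 1 : V d)‖ := by simp [hk]
  have h1 : ∀ᵐ (σ : S d) ∂(surface d),
      inner ℝ (EuclideanSpace.single i₀ 1 : V d) (σ : V d) ∈ Ioo (-1 : ℝ) 1 := by
    filter_upwards [ae_sphere_coord_ne_zero hd] with σ hσ
    obtain ⟨j, hj⟩ : ∃ j, j ≠ i₀ := by
      have : Nontrivial (Fin d) := Fin.nontrivial_iff_two_le.2 hd
      exact exists_ne i₀
    have hq : 0 < 1 - (σ : V d) i₀ ^ 2 :=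
      lt_of_lt_of_le (by have := hσ j; positivity) (sq_coord_le σ hj)
    have : (σ : V d) i₀ ^ 2 < 1 := by linarith
    rw [sq_lt_one_iff_abs_lt_one, abs_lt] at this
    simpa [EuclideanSpace.inner_single_left] using this
  have h2 := ae_of_ae_map (μ := surface d) (f := fun σ : S d => inner ℝ k (σ : V d))
    (p := fun z => z ∈ Ioo (-1 : ℝ) 1) (measurable_inner_sphere k).aemeasurable
  apply h2
  rw [(measurePreserving_inner he).map_eq]
  exact (ae_map_iff (measurable_inner_sphere _).aemeasurable measurableSet_Ioo).2 h1

theorem IsHardPotentialCutoff.exists_bound {d : ℕ} (hd : 2 ≤ d) {β : ℝ} {h : ℝ → ℝ}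
    (hB : IsHardPotentialCutoff d β h) :
    ∃ α C : ℝ, 0 ≤ α ∧ α < (d : ℝ) - 1 ∧ 0 ≤ C ∧
      ∀ z ∈ Ioo (-1 : ℝ) 1, h z ≤ C * (1 - z ^ 2) ^ (-(α / 2)) := by
  obtain ⟨α, hα, C, hC⟩ := hB.cutoff
  have hd1 : (0 : ℝ) < (d : ℝ) - 1 := by
    have : (2 : ℝ) ≤ d := by exact_mod_cast hd
    linarith
  -- A negative exponent may be raised to 0, since the base 1 − z² is at most 1.
  refine ⟨max α 0, max C 0, le_max_right _ _, max_lt hα hd1, le_max_right _ _, fun z hz => ?_⟩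
  have hq : 0 < 1 - z ^ 2 := by nlinarith [hz.1, hz.2]
  have hθ : Real.arccos z ∈ Ioo (0 : ℝ) Real.pi :=
    ⟨Real.arccos_pos.2 hz.2, Real.arccos_lt_pi.2 hz.1⟩
  have h1 := hC _ hθ
  rw [Real.cos_arccos hz.1.le hz.2.le, Real.sin_arccos, Real.sqrt_eq_rpow,
    ← Real.rpow_mul hq.le] at h1
  have h2 : h z ≤ max C 0 * (1 - z ^ 2) ^ (-(1 / 2 * α)) := by
    rw [Real.rpow_neg hq.le, ← div_eq_mul_inv, le_div_iff₀ (by positivity)]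
    exact h1.trans (le_max_left _ _)
  refine h2.trans ?_
  gcongr ?_ * ?_
  refine Real.rpow_le_rpow_of_exponent_ge hq (by nlinarith [sq_nonneg z]) ?_
  linarith [le_max_left α 0]

/-- The cutoff bound gives integrability for one direction; rotation invariance transfers both
integrability and the value `A` to all others. -/
theorem IsHardPotentialCutoff.exists_isAngularKernel {d : ℕ} (hd : 2 ≤ d) {β : ℝ} {h : ℝ → ℝ}
    (hB : IsHardPotentialCutoff d β h) :
    ∃ A, IsAngularKernel d ((Ioo (-1 : ℝ) 1).indicator h) A := by
  obtain ⟨α, C, h0, hα, hC0, hC⟩ := hB.exists_bound hd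
  set i₀ : Fin d := ⟨0, by omega⟩
  set g := (Ioo (-1 : ℝ) 1).indicator h with hg
  have hgm : Measurable g := hB.measurable.indicator measurableSet_Ioo
  have hg0 : ∀ z, 0 ≤ g z := fun z => indicator_nonneg hB.nonneg z
  set e : V d := EuclideanSpace.single i₀ 1
  have he : ‖e‖ = 1 := by simp [e]
  have hi : Integrable (fun σ : S d => g (inner ℝ e (σ : V d))) (surface d) := by
    refine ((integrable_sin_rpow hd i₀ h0 hα).const_mul C).mono'
      (hgm.comp (measurable_inner_sphere e)).aestronglyMeasurable ?_
    filter_upwards [ae_inner_mem_Ioo hd he] with σ hσ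
    rw [Real.norm_of_nonneg (hg0 _), hg, indicator_of_mem hσ]
    simpa [e, EuclideanSpace.inner_single_left] using hC _ hσ
  refine ⟨∫ σ : S d, g (inner ℝ e (σ : V d)) ∂(surface d), hgm, hg0, fun k hk => ?_, fun k hk => ?_⟩
  · have h1 := measurePreserving_inner (hk.trans he.symm)
    exact (h1.integrable_comp (g := g) hgm.aestronglyMeasurable).2
      (((measurePreserving_inner (rfl : ‖e‖ = ‖e‖)).integrable_comp (g := g)
        hgm.aestronglyMeasurable).1 hi)
  · have h1 := measurePreserving_inner (hk.trans he.symm)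
    have h2 := measurePreserving_inner (rfl : ‖e‖ = ‖e‖)
    rw [← integral_map (φ := fun σ : S d => inner ℝ k (σ : V d)) (f := g) h1.aemeasurable
        hgm.aestronglyMeasurable,
      ← integral_map (φ := fun σ : S d => inner ℝ e (σ : V d)) (f := g) h2.aemeasurable
        hgm.aestronglyMeasurable, h1.map_eq]

/-- The cosine takes the values ±1 only on a null set of σ, and for u = 0 the factor |u|^β vanishes.
So `h` may be replaced by 0 outside (−1, 1), which makes it nonnegative everywhere. -/
theorem kernel_indicator {d : ℕ} (hd : 2 ≤ d) {β : ℝ} (hβ : 0 < β) (h : ℝ → ℝ) (u : V d) :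
    ∀ᵐ (σ : S d) ∂(surface d),
      kernel β h u σ = kernel β ((Ioo (-1 : ℝ) 1).indicator h) u σ := by
  rcases eq_or_ne u 0 with rfl | hu
  · exact .of_forall fun σ => by simp [kernel, Real.zero_rpow hβ.ne']
  have hk : ‖(‖u‖⁻¹ : ℝ) • u‖ = 1 := by simp [norm_smul, hu]
  filter_upwards [ae_inner_mem_Ioo hd hk] with σ hσ
  rw [real_inner_smul_left, mul_comm, ← div_eq_mul_inv] at hσ
  simp only [kernel]
  rw [indicator_of_mem hσ]

theorem collision_indicator {d : ℕ} (hd : 2 ≤ d) {β : ℝ} (hβ : 0 < β) (h : ℝ → ℝ) :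
    (collision (kernel β h) : (V d → ℝ) → V d → ℝ)
      = collision (kernel β ((Ioo (-1 : ℝ) 1).indicator h)) := by
  ext g v
  simp only [collision]
  congr 1 with w
  refine integral_congr_ae ?_
  filter_upwards [kernel_indicator hd hβ h (v - w)] with σ hσ
  rw [hσ]

namespace IsAngularKernel
variable {d : ℕ} {h : ℝ → ℝ} {A β : ℝ}

theorem mass_nonneg (H : IsAngularKernel d h A) (hd : 2 ≤ d) : 0 ≤ A := by
  rw [← H.mass (EuclideanSpace.single ⟨0, by omega⟩ 1) (by simp)]
  exact integral_nonneg fun σ => H.nonneg _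

theorem kernel_nonneg (H : IsAngularKernel d h A) (u : V d) (σ : S d) : 0 ≤ kernel β h u σ :=
  mul_nonneg (by positivity) (H.nonneg _)

theorem kernel_eq {u : V d} {σ : S d} :
    kernel β h u σ = ‖u‖ ^ β * h (inner ℝ ((‖u‖⁻¹ : ℝ) • u) (σ : V d)) := by
  rw [kernel, real_inner_smul_left, mul_comm _ (inner ℝ u _), ← div_eq_mul_inv]

theorem integrable_kernel (H : IsAngularKernel d h A) (hβ : 0 < β) (u : V d) :
    Integrable (fun σ => kernel β h u σ) (surface d) := by
  rcases eq_or_ne u 0 with rfl | hu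
  · simp [kernel, Real.zero_rpow hβ.ne']
  simp only [kernel_eq]
  exact (H.integrable _ (by simp [norm_smul, hu])).const_mul _

theorem integral_kernel (H : IsAngularKernel d h A) (hβ : 0 < β) (u : V d) :
    ∫ σ, kernel β h u σ ∂(surface d) = A * ‖u‖ ^ β := by
  rcases eq_or_ne u 0 with rfl | hu
  · simp [kernel, Real.zero_rpow hβ.ne']
  simp only [kernel_eq]
  rw [integral_const_mul, H.mass _ (by simp [norm_smul, hu]), mul_comm]

/-- Angular averages of high powers of `(1 + |e · σ|) / 2` are small, uniformly in the relative
velocity and in `e`. -/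
theorem exists_average_le (H : IsAngularKernel d h A) (hd : 2 ≤ d) {ε : ℝ} (hε : 0 < ε) :
    ∃ k₀ : ℕ, ∀ k, k₀ ≤ k → ∀ u e : V d, ‖u‖ = 1 → ‖e‖ ≤ 1 →
      ∫ σ : S d, ((1 + |inner ℝ e (σ : V d)|) / 2) ^ k * h (inner ℝ u (σ : V d)) ∂(surface d)
        ≤ ε := by
  set e₀ : V d := EuclideanSpace.single ⟨0, by omega⟩ 1
  have he₀ : ‖e₀‖ = 1 := by simp [e₀]
  set ν := (surface d).map (fun σ : S d => inner ℝ e₀ (σ : V d)) with hν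
  have hmp : ∀ k : V d, ‖k‖ = 1 → MeasurePreserving (fun σ : S d => inner ℝ k (σ : V d))
    (surface d) ν := fun k hk => measurePreserving_inner (hk.trans he₀.symm)
  have hfin : IsFiniteMeasure ν := by rw [hν]; infer_instance
  have hhν : Integrable h ν := ((hmp e₀ he₀).integrable_comp
    H.measurable.aestronglyMeasurable).1 (H.integrable e₀ he₀)
  have hint : ∀ k : V d, ‖k‖ = 1 → ∀ g : ℝ → ℝ, Measurable g →
      ∫ σ : S d, g (inner ℝ k (σ : V d)) ∂(surface d) = ∫ z, g z ∂ν := fun k hk g hg => by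
    rw [← (hmp k hk).map_eq, integral_map (hmp k hk).aemeasurable hg.aestronglyMeasurable]
  have hlt : ∀ᵐ z ∂ν, |z| < 1 := by
    rw [hν, ae_map_iff (measurable_inner_sphere _).aemeasurable
      (measurableSet_lt (by fun_prop) measurable_const)]
    filter_upwards [ae_inner_mem_Ioo hd he₀] with σ hσ
    exact abs_lt.2 hσ
  -- large values of the angular function
  have ht1 : Tendsto (fun n : ℕ => ∫ z, {z | (n : ℝ) < h z}.indicator h z ∂ν) atTop (𝓝 0) := by
    have := tendsto_integral_of_dominated_convergence (μ := ν) (f := fun _ => (0 : ℝ))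
      (F := fun (n : ℕ) z => {z | (n : ℝ) < h z}.indicator h z) h
      (fun n => (H.measurable.indicator
        (measurableSet_lt measurable_const H.measurable)).aestronglyMeasurable) hhν
      (fun n => .of_forall fun z => by
        rw [Real.norm_of_nonneg (indicator_nonneg (fun z _ => H.nonneg z) z)]
        exact indicator_le_self' (fun z _ => H.nonneg z) z)
      (.of_forall fun z => by
        obtain ⟨N, hN⟩ := exists_nat_ge (h z)
        refine tendsto_const_nhds.congr' ?_
        filter_upwards [eventually_ge_atTop N] with n hn
        rw [indicator_of_notMem]
        simp only [mem_ofPred_eq, not_lt]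
        exact hN.trans (by exact_mod_cast hn))
    simpa using this
  obtain ⟨N, hN⟩ := (ht1.eventually (gt_mem_nhds (half_pos hε))).exists
  have ht2 : Tendsto (fun k : ℕ => ∫ z, (N : ℝ) * ((1 + |z|) / 2) ^ k ∂ν) atTop (𝓝 0) := by
    have := tendsto_integral_of_dominated_convergence (μ := ν) (f := fun _ => (0 : ℝ))
      (F := fun (k : ℕ) z => (N : ℝ) * ((1 + |z|) / 2) ^ k) (fun _ => N)
      (fun n => by fun_prop) (integrable_const _)
      (fun n => by
        filter_upwards [hlt] with z hz
        rw [Real.norm_of_nonneg (by positivity)]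
        exact mul_le_of_le_one_right (by positivity) (pow_le_one₀ (by positivity) (by linarith)))
      (by
        filter_upwards [hlt] with z hz
        have := (tendsto_pow_atTop_nhds_zero_of_lt_one (r := (1 + |z|) / 2) (by positivity)
          (by linarith)).const_mul (N : ℝ)
        simpa using this)
    simpa using this
  obtain ⟨k₀, hk₀⟩ := eventually_atTop.1 (ht2.eventually (gt_mem_nhds (half_pos hε)))
  refine ⟨k₀, fun k hk u e hu he => ?_⟩
  -- Enlarging e to a unit vector increases the integrand and makes ν the law of e'·σ.
  obtain ⟨e', he', hee⟩ : ∃ e' : V d, ‖e'‖ = 1 ∧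
      ∀ σ : S d, |inner ℝ e (σ : V d)| ≤ |inner ℝ e' (σ : V d)| := by
    rcases eq_or_ne e 0 with rfl | h0
    · exact ⟨e₀, he₀, by simp⟩
    · refine ⟨(‖e‖⁻¹ : ℝ) • e, by simp [norm_smul, h0], fun σ => ?_⟩
      rw [real_inner_smul_left, abs_mul]
      refine le_mul_of_one_le_left (abs_nonneg _) ?_
      rw [abs_of_nonneg (by positivity)]
      exact (one_le_inv₀ (norm_pos_iff.2 h0)).2 he
  have hle1 : ∀ σ : S d, |inner ℝ e' (σ : V d)| ≤ 1 := fun σ => by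
    have := abs_real_inner_le_norm e' (σ : V d)
    rwa [he', norm_eq_of_mem_sphere, mul_one] at this
  have i1 : Integrable (fun σ : S d => (N : ℝ) * ((1 + |inner ℝ e' (σ : V d)|) / 2) ^ k)
      (surface d) := by
    refine Integrable.of_bound (C := N) (by fun_prop) (.of_forall fun σ => ?_)
    rw [Real.norm_of_nonneg (by positivity)]
    exact mul_le_of_le_one_right (by positivity)
      (pow_le_one₀ (by positivity) (by linarith [hle1 σ]))
  have i2 : Integrable (fun σ : S d => {z | (N : ℝ) < h z}.indicator h (inner ℝ u (σ : V d)))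
      (surface d) := by
    refine ((hmp u hu).integrable_comp (g := {z | (N : ℝ) < h z}.indicator h) ?_).2 ?_
    · exact (H.measurable.indicator
        (measurableSet_lt measurable_const H.measurable)).aestronglyMeasurable
    · exact hhν.indicator (measurableSet_lt measurable_const H.measurable)
  -- Where h ≤ N the first term suffices; elsewhere the power is at most 1. The splitting decouples
  -- e from u: each term involves a single direction, so its integral is independent of that
  -- direction.
  calc _ ≤ ∫ σ : S d, ((N : ℝ) * ((1 + |inner ℝ e' (σ : V d)|) / 2) ^ k
          + {z | (N : ℝ) < h z}.indicator h (inner ℝ u (σ : V d))) ∂(surface d) := by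
        refine integral_mono_of_nonneg (.of_forall fun σ => ?_) (i1.add i2)
          (.of_forall fun σ => ?_)
        · exact mul_nonneg (by positivity) (H.nonneg _)
        · have b1 : ((1 + |inner ℝ e (σ : V d)|) / 2) ^ k
              ≤ ((1 + |inner ℝ e' (σ : V d)|) / 2) ^ k := by
            have := hee σ
            gcongr
          have b2 : ((1 + |inner ℝ e' (σ : V d)|) / 2) ^ k ≤ 1 :=
            pow_le_one₀ (by positivity) (by linarith [hle1 σ])
          have b3 := H.nonneg (inner ℝ u (σ : V d))
          have b4 : 0 ≤ ((1 + |inner ℝ e' (σ : V d)|) / 2) ^ k := by positivity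
          dsimp only
          by_cases hz : (N : ℝ) < h (inner ℝ u (σ : V d))
          · rw [indicator_of_mem (show inner ℝ u (σ : V d) ∈ {z | (N : ℝ) < h z} from hz)]
            nlinarith [mul_nonneg (Nat.cast_nonneg (α := ℝ) N) b4]
          · rw [indicator_of_notMem (show inner ℝ u (σ : V d) ∉ {z | (N : ℝ) < h z} from hz)]
            push Not at hz
            nlinarith
    _ = (∫ z, (N : ℝ) * ((1 + |z|) / 2) ^ k ∂ν) + ∫ z, {z | (N : ℝ) < h z}.indicator h z ∂ν := by
        rw [integral_add i1 i2, hint e' he' (fun z => (N : ℝ) * ((1 + |z|) / 2) ^ k) (by fun_prop),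
          hint u hu _ (H.measurable.indicator (measurableSet_lt measurable_const H.measurable))]
    _ ≤ ε := by linarith [hk₀ k hk]

end IsAngularKernel

/-! ### Energies after a collision, and microreversibility -/

section

variable {d : ℕ}

/-- With E = |v|² + |v_*|², take e = |v − v_*| (v + v_*)/E. The parallelogram law and 2|v − v_*||v +
v_*| ≤ |v − v_*|² + |v + v_*|² = 2E give |e| ≤ 1. -/
theorem exists_postcollisional_cosine (v w : V d) :
    ∃ e : V d, ‖e‖ ≤ 1 ∧ ∀ σ : S d,
      ‖vPrime v w σ‖ ^ 2 = (‖v‖ ^ 2 + ‖w‖ ^ 2) * ((1 + inner ℝ e (σ : V d)) / 2) ∧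
      ‖vPrimeStar v w σ‖ ^ 2 = (‖v‖ ^ 2 + ‖w‖ ^ 2) * ((1 - inner ℝ e (σ : V d)) / 2) := by
  have hpar : ‖v + w‖ ^ 2 + ‖v - w‖ ^ 2 = 2 * (‖v‖ ^ 2 + ‖w‖ ^ 2) := by
    rw [norm_add_sq_real, norm_sub_sq_real]; ring
  set E := ‖v‖ ^ 2 + ‖w‖ ^ 2 with hE
  refine ⟨(‖v - w‖ / E) • (v + w), ?_, fun σ => ?_⟩
  · rw [norm_smul, Real.norm_of_nonneg (by positivity), div_mul_eq_mul_div]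
    refine div_le_one_of_le₀ ?_ (by positivity)
    nlinarith [sq_nonneg (‖v - w‖ - ‖v + w‖)]
  · have hσ : ‖(σ : V d)‖ = 1 := norm_eq_of_mem_sphere σ
    have key : E * inner ℝ ((‖v - w‖ / E) • (v + w)) (σ : V d)
        = ‖v - w‖ * inner ℝ (v + w) (σ : V d) := by
      rw [real_inner_smul_left]
      rcases eq_or_ne E 0 with h0 | h0
      · have h1 : ‖v - w‖ = 0 := by
          have : ‖v - w‖ ^ 2 ≤ 0 := by nlinarith [sq_nonneg ‖v + w‖]
          exact pow_eq_zero_iff (two_ne_zero) |>.1 (le_antisymm this (sq_nonneg _))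
        simp [h0, h1]
      · field_simp
    have hn : ‖(1 / 2 : ℝ) • (v + w)‖ ^ 2 = ‖v + w‖ ^ 2 / 4 := by
      rw [norm_smul, mul_pow]; norm_num; ring
    have hs : ‖(‖v - w‖ / 2) • (σ : V d)‖ ^ 2 = ‖v - w‖ ^ 2 / 4 := by
      rw [norm_smul, mul_pow, hσ, Real.norm_eq_abs, sq_abs]; ring
    constructor
    · rw [vPrime, norm_add_sq_real, hn, hs, real_inner_smul_left, real_inner_smul_right]
      linarith
    · rw [vPrimeStar, norm_sub_sq_real, hn, hs, real_inner_smul_left, real_inner_smul_right]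
      linarith

theorem norm_sq_vPrime_add (v w : V d) (σ : S d) :
    ‖vPrime v w σ‖ ^ 2 + ‖vPrimeStar v w σ‖ ^ 2 = ‖v‖ ^ 2 + ‖w‖ ^ 2 := by
  obtain ⟨e, -, he⟩ := exists_postcollisional_cosine v w
  rw [(he σ).1, (he σ).2]; ring

/-- The measure `dv dw dσ`. -/
abbrev collisionMeasure (d : ℕ) : Measure ((V d × V d) × S d) :=
  ((volume : Measure (V d)).prod volume).prod (surface d)

theorem measurable_vPrime :
    Measurable (fun p : (V d × V d) × S d => vPrime p.1.1 p.1.2 p.2) := by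
  unfold vPrime; fun_prop

theorem measurable_vPrimeStar :
    Measurable (fun p : (V d × V d) × S d => vPrimeStar p.1.1 p.1.2 p.2) := by
  unfold vPrimeStar; fun_prop

/-- The collision kernel as a symmetric function of the two relative velocities. -/
def symmKernel (β : ℝ) (h : ℝ → ℝ) (q : V d × V d) : ℝ :=
  ‖q.1‖ ^ (β / 2) * ‖q.2‖ ^ (β / 2) * h (inner ℝ q.1 q.2 / (‖q.1‖ * ‖q.2‖))

theorem kernel_eq_symmKernel {β : ℝ} (hβ : 0 < β) (h : ℝ → ℝ) (u : V d) (σ : S d) :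
    kernel β h u σ = symmKernel β h (u, ‖u‖ • (σ : V d)) := by
  rcases eq_or_ne u 0 with rfl | hu
  · simp [kernel, symmKernel, Real.zero_rpow hβ.ne', Real.zero_rpow (half_pos hβ).ne']
  have hu' : 0 < ‖u‖ := norm_pos_iff.2 hu
  simp only [kernel, symmKernel, norm_smul, norm_norm, norm_eq_of_mem_sphere, mul_one,
    real_inner_smul_right]
  rw [← Real.rpow_add hu', add_halves, mul_div_mul_left _ _ hu'.ne']

theorem symmKernel_swap (β : ℝ) (h : ℝ → ℝ) (u y : V d) :
    symmKernel β h (y, u) = symmKernel β h (u, y) := by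
  simp only [symmKernel, real_inner_comm u y]
  rw [mul_comm (‖y‖ ^ (β / 2)), mul_comm ‖y‖]

theorem symmKernel_neg (β : ℝ) (h : ℝ → ℝ) (u y : V d) :
    symmKernel β h (-u, -y) = symmKernel β h (u, y) := by
  simp [symmKernel]

theorem integral_comp_measurePreserving {X : Type*} [MeasurableSpace X] {Y : Type*}
    [MeasurableSpace Y] {μ : Measure X} {ν : Measure Y} {T : X → Y} (hT : MeasurePreserving T μ ν)
    {R : Y → Y} (hR : MeasurePreserving R ν ν) {G : Y → ℝ} (hG : Measurable G) :
    (Integrable (fun x => G (R (T x))) μ ↔ Integrable (fun x => G (T x)) μ) ∧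
      ∫ x, G (R (T x)) ∂μ = ∫ x, G (T x) ∂μ := by
  have h1 := hR.comp hT
  refine ⟨(h1.integrable_comp hG.aestronglyMeasurable).trans
    (hT.integrable_comp hG.aestronglyMeasurable).symm, ?_⟩
  have e1 := integral_map (f := G) h1.aemeasurable hG.aestronglyMeasurable
  have e2 := integral_map (f := G) hT.aemeasurable hG.aestronglyMeasurable
  rw [h1.map_eq] at e1
  rw [hT.map_eq] at e2
  exact e1.symm.trans e2

theorem half_smul_add_add (v w : V d) : (1 / 2 : ℝ) • (v + w) + (1 / 2 : ℝ) • (v - w) = v := by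
  module

theorem half_smul_add_sub (v w : V d) : (1 / 2 : ℝ) • (v + w) - (1 / 2 : ℝ) • (v - w) = w := by
  module

theorem vPrime_eq (v w : V d) (σ : S d) :
    vPrime v w σ = (1 / 2 : ℝ) • (v + w) + (1 / 2 : ℝ) • (‖v - w‖ • (σ : V d)) := by
  rw [vPrime, smul_smul]; congr 2; ring

theorem vPrimeStar_eq (v w : V d) (σ : S d) :
    vPrimeStar v w σ = (1 / 2 : ℝ) • (v + w) - (1 / 2 : ℝ) • (‖v - w‖ • (σ : V d)) := by
  rw [vPrimeStar, smul_smul]; congr 2; ring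

section
variable {h : ℝ → ℝ} {β : ℝ}

/-- Microreversibility. -/
theorem integral_prePost (hd : 2 ≤ d) (hβ : 0 < β) (hh : Measurable h)
    {Ψ : V d × V d × V d × V d → ℝ} (hΨ : Measurable Ψ) :
    (Integrable (fun p : (V d × V d) × S d =>
        Ψ (vPrime p.1.1 p.1.2 p.2, vPrimeStar p.1.1 p.1.2 p.2, p.1.1, p.1.2)
          * kernel β h (p.1.1 - p.1.2) p.2) (collisionMeasure d) ↔
      Integrable (fun p : (V d × V d) × S d =>
        Ψ (p.1.1, p.1.2, vPrime p.1.1 p.1.2 p.2, vPrimeStar p.1.1 p.1.2 p.2)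
          * kernel β h (p.1.1 - p.1.2) p.2) (collisionMeasure d)) ∧
    ∫ p : (V d × V d) × S d, Ψ (vPrime p.1.1 p.1.2 p.2, vPrimeStar p.1.1 p.1.2 p.2, p.1.1, p.1.2)
          * kernel β h (p.1.1 - p.1.2) p.2 ∂(collisionMeasure d)
      = ∫ p : (V d × V d) × S d, Ψ (p.1.1, p.1.2, vPrime p.1.1 p.1.2 p.2, vPrimeStar p.1.1 p.1.2 p.2)
          * kernel β h (p.1.1 - p.1.2) p.2 ∂(collisionMeasure d) := by
  set c : ℝ := 1 / 2 with hc
  -- The integrand in the coordinates (mean velocity, u, y = |u|σ). Precollisional velocities are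
  -- recovered from u, postcollisional ones from y, so exchanging u and y exchanges the two pairs.
  set G : V d × V d × V d → ℝ := fun q =>
    Ψ (q.1 + c • q.2.1, q.1 - c • q.2.1, q.1 + c • q.2.2, q.1 - c • q.2.2)
      * symmKernel β h (q.2.1, q.2.2) with hG
  have hGm : Measurable G := by
    simp only [hG, symmKernel]
    fun_prop
  have := integral_comp_measurePreserving (measurePreserving_collisionCoordinates d)
    ((MeasurePreserving.id (volume : Measure (V d))).prod
      (measurePreserving_swap_collisionPairs d hd)) hGm
  simp only [hG, Prod.map, Prod.swap, id, half_smul_add_add, half_smul_add_sub, ← vPrime_eq,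
    ← vPrimeStar_eq, symmKernel_swap, ← kernel_eq_symmKernel hβ, hc] at this
  exact this

/-- Exchange of the two colliding particles. -/
theorem integral_exchange (hβ : 0 < β) (hh : Measurable h)
    {Ψ : V d × V d × V d × V d → ℝ} (hΨ : Measurable Ψ) :
    (Integrable (fun p : (V d × V d) × S d =>
        Ψ (p.1.2, p.1.1, vPrimeStar p.1.1 p.1.2 p.2, vPrime p.1.1 p.1.2 p.2)
          * kernel β h (p.1.1 - p.1.2) p.2) (collisionMeasure d) ↔
      Integrable (fun p : (V d × V d) × S d =>
        Ψ (p.1.1, p.1.2, vPrime p.1.1 p.1.2 p.2, vPrimeStar p.1.1 p.1.2 p.2)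
          * kernel β h (p.1.1 - p.1.2) p.2) (collisionMeasure d)) ∧
    ∫ p : (V d × V d) × S d, Ψ (p.1.2, p.1.1, vPrimeStar p.1.1 p.1.2 p.2, vPrime p.1.1 p.1.2 p.2)
          * kernel β h (p.1.1 - p.1.2) p.2 ∂(collisionMeasure d)
      = ∫ p : (V d × V d) × S d, Ψ (p.1.1, p.1.2, vPrime p.1.1 p.1.2 p.2, vPrimeStar p.1.1 p.1.2 p.2)
          * kernel β h (p.1.1 - p.1.2) p.2 ∂(collisionMeasure d) := by
  set c : ℝ := 1 / 2 with hc
  -- In the same coordinates, relabelling the particles changes the sign of both u and y.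
  set G : V d × V d × V d → ℝ := fun q =>
    Ψ (q.1 + c • q.2.1, q.1 - c • q.2.1, q.1 + c • q.2.2, q.1 - c • q.2.2)
      * symmKernel β h (q.2.1, q.2.2) with hG
  have hGm : Measurable G := by
    simp only [hG, symmKernel]
    fun_prop
  have := integral_comp_measurePreserving (measurePreserving_collisionCoordinates d)
    ((MeasurePreserving.id (volume : Measure (V d))).prod
      (measurePreserving_neg_collisionPairs d)) hGm
  simp only [hG, Prod.map, id, half_smul_add_add, half_smul_add_sub, ← vPrime_eq,
    ← vPrimeStar_eq, symmKernel_neg, ← kernel_eq_symmKernel hβ, hc, smul_neg, ← sub_eq_add_neg,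
    sub_neg_eq_add] at this
  exact this

end

end

/-! ### Weak form of the collision operator and of the equation -/

section

variable {d : ℕ} {h : ℝ → ℝ} {A β : ℝ}

theorem norm_sub_rpow_le (hβ : 0 < β) (hβ1 : β ≤ 1) (v w : V d) :
    ‖v - w‖ ^ β ≤ ‖v‖ ^ β + ‖w‖ ^ β :=
  (Real.rpow_le_rpow (norm_nonneg _) (norm_sub_le v w) hβ.le).trans
    (Real.rpow_add_le_add_rpow (norm_nonneg _) (norm_nonneg _) hβ.le hβ1)

theorem norm_rpow_le (hβ : 0 < β) (hβ1 : β ≤ 1) (v : V d) : ‖v‖ ^ β ≤ 1 + ‖v‖ ^ 2 := by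
  rcases le_total ‖v‖ 1 with h1 | h1
  · exact (Real.rpow_le_one (norm_nonneg _) h1 hβ.le).trans (by nlinarith [sq_nonneg ‖v‖])
  · have : ‖v‖ ^ β ≤ ‖v‖ ^ (2 : ℝ) := Real.rpow_le_rpow_of_exponent_le h1 (by linarith)
    rw [Real.rpow_two] at this
    linarith

theorem norm_sub_rpow_le_mul (hβ : 0 < β) (hβ1 : β ≤ 1) (v w : V d) :
    ‖v - w‖ ^ β ≤ 2 * ((1 + ‖v‖ ^ 2) * (1 + ‖w‖ ^ 2)) := by
  nlinarith [norm_sub_rpow_le hβ hβ1 v w, norm_rpow_le hβ hβ1 v, norm_rpow_le hβ hβ1 w,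
    mul_nonneg (sq_nonneg ‖v‖) (sq_nonneg ‖w‖), sq_nonneg ‖v‖, sq_nonneg ‖w‖]

theorem one_add_norm_sq_vPrime_le (v w : V d) (σ : S d) :
    1 + ‖vPrime v w σ‖ ^ 2 ≤ (1 + ‖v‖ ^ 2) * (1 + ‖w‖ ^ 2) := by
  nlinarith [norm_sq_vPrime_add v w σ, sq_nonneg ‖vPrimeStar v w σ‖,
    mul_nonneg (sq_nonneg ‖v‖) (sq_nonneg ‖w‖)]

theorem one_add_norm_sq_vPrimeStar_le (v w : V d) (σ : S d) :
    1 + ‖vPrimeStar v w σ‖ ^ 2 ≤ (1 + ‖v‖ ^ 2) * (1 + ‖w‖ ^ 2) := by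
  nlinarith [norm_sq_vPrime_add v w σ, sq_nonneg ‖vPrime v w σ‖,
    mul_nonneg (sq_nonneg ‖v‖) (sq_nonneg ‖w‖)]

theorem measurable_kernel_sub (hh : Measurable h) :
    Measurable (fun p : (V d × V d) × S d => kernel β h (p.1.1 - p.1.2) p.2) := by
  unfold kernel; fun_prop

/-- Absolute integrability of the collision integrals against polynomially bounded weights. -/
theorem integrable_collision (H : IsAngularKernel d h A) (hA : 0 ≤ A) (hβ : 0 < β) (hβ1 : β ≤ 1)
    {g : V d → ℝ} (hg : Measurable g) {k : ℕ}
    (hgi : Integrable (fun v => |g v| * (1 + ‖v‖ ^ 2) ^ (k + 1)))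
    {q : (V d × V d) × S d → ℝ} (hq : Measurable q) {C : ℝ} (hC0 : 0 ≤ C)
    (hC : ∀ p, |q p| ≤ C * ((1 + ‖p.1.1‖ ^ 2) * (1 + ‖p.1.2‖ ^ 2)) ^ k) :
    Integrable (fun p : (V d × V d) × S d =>
      g p.1.1 * g p.1.2 * q p * kernel β h (p.1.1 - p.1.2) p.2) (collisionMeasure d) ∧
    ∫ p : (V d × V d) × S d, ‖g p.1.1 * g p.1.2 * q p * kernel β h (p.1.1 - p.1.2) p.2‖
      ∂(collisionMeasure d) ≤ 2 * A * C * (∫ v, |g v| * (1 + ‖v‖ ^ 2) ^ (k + 1)) ^ 2 := by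
  set b : V d × V d → ℝ := fun z =>
    C * (|g z.1| * |g z.2| * ((1 + ‖z.1‖ ^ 2) * (1 + ‖z.2‖ ^ 2)) ^ k) with hb
  have hb0 : ∀ z, 0 ≤ b z := fun z => by positivity
  have hbm : Measurable b := by simp only [hb]; fun_prop
  have hkm := measurable_kernel_sub (d := d) (β := β) H.measurable
  have hdom : Integrable (fun z : V d × V d => 2 * A * C *
      ((|g z.1| * (1 + ‖z.1‖ ^ 2) ^ (k + 1)) * (|g z.2| * (1 + ‖z.2‖ ^ 2) ^ (k + 1))))
      ((volume : Measure (V d)).prod volume) := (hgi.mul_prod hgi).const_mul _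
  have hle : ∀ z : V d × V d, b z * (A * ‖z.1 - z.2‖ ^ β) ≤ 2 * A * C *
      ((|g z.1| * (1 + ‖z.1‖ ^ 2) ^ (k + 1)) * (|g z.2| * (1 + ‖z.2‖ ^ 2) ^ (k + 1))) := fun z => by
    calc b z * (A * ‖z.1 - z.2‖ ^ β)
        ≤ b z * (A * (2 * ((1 + ‖z.1‖ ^ 2) * (1 + ‖z.2‖ ^ 2)))) := by
          gcongr
          exact norm_sub_rpow_le_mul hβ hβ1 _ _
      _ = _ := by simp only [hb, mul_pow]; ring
  have hsec : ∀ z : V d × V d,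
      ∫ σ, ‖b z * kernel β h (z.1 - z.2) σ‖ ∂(surface d) = b z * (A * ‖z.1 - z.2‖ ^ β) := by
    intro z
    rw [← H.integral_kernel hβ, ← integral_const_mul]
    congr 1 with σ
    rw [Real.norm_of_nonneg (mul_nonneg (hb0 z) (H.kernel_nonneg _ _))]
  have hbi : Integrable (fun p : (V d × V d) × S d => b p.1 * kernel β h (p.1.1 - p.1.2) p.2)
      (collisionMeasure d) := by
    refine (integrable_prod_iff (Measurable.aestronglyMeasurable (by fun_prop))).2 ⟨?_, ?_⟩
    · exact .of_forall fun z => (H.integrable_kernel hβ (z.1 - z.2)).const_mul (b z)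
    · simp only [hsec]
      refine hdom.mono' (Measurable.aestronglyMeasurable (by fun_prop)) (.of_forall fun z => ?_)
      rw [Real.norm_of_nonneg (mul_nonneg (hb0 z) (by positivity))]
      exact hle z
  have hpt : ∀ p : (V d × V d) × S d, ‖g p.1.1 * g p.1.2 * q p * kernel β h (p.1.1 - p.1.2) p.2‖
      ≤ b p.1 * kernel β h (p.1.1 - p.1.2) p.2 := fun p => by
    rw [norm_mul, Real.norm_of_nonneg (H.kernel_nonneg _ _)]
    refine mul_le_mul_of_nonneg_right ?_ (H.kernel_nonneg _ _)
    rw [norm_mul, norm_mul, Real.norm_eq_abs, Real.norm_eq_abs, Real.norm_eq_abs]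
    calc |g p.1.1| * |g p.1.2| * |q p| ≤ |g p.1.1| * |g p.1.2| *
          (C * ((1 + ‖p.1.1‖ ^ 2) * (1 + ‖p.1.2‖ ^ 2)) ^ k) := by
          gcongr; exact hC p
      _ = _ := by simp only [hb]; ring
  have hi := hbi.mono' (Measurable.aestronglyMeasurable (by fun_prop)) (.of_forall hpt)
  refine ⟨hi, (integral_mono hi.norm hbi hpt).trans ?_⟩
  rw [integral_prod _ hbi]
  have hsec' : ∀ z : V d × V d,
      ∫ σ, b z * kernel β h (z.1 - z.2) σ ∂(surface d) = b z * (A * ‖z.1 - z.2‖ ^ β) := fun z => by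
    rw [← H.integral_kernel hβ, ← integral_const_mul]
  simp only [hsec']
  calc _ ≤ ∫ z : V d × V d, 2 * A * C *
      ((|g z.1| * (1 + ‖z.1‖ ^ 2) ^ (k + 1)) * (|g z.2| * (1 + ‖z.2‖ ^ 2) ^ (k + 1)))
      ∂((volume : Measure (V d)).prod volume) := by
        refine integral_mono_of_nonneg (.of_forall fun z => mul_nonneg (hb0 z) (by positivity)) hdom
          (.of_forall hle)
    _ = _ := by
        rw [integral_const_mul, integral_prod_mul (fun v : V d => |g v| * (1 + ‖v‖ ^ 2) ^ (k + 1))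
          (fun v : V d => |g v| * (1 + ‖v‖ ^ 2) ^ (k + 1))]
        ring

theorem integral_norm_integral_le {X Y : Type*} [MeasurableSpace X] [MeasurableSpace Y]
    {μ : Measure X} {ν : Measure Y} [SFinite μ] [SFinite ν] {F : X × Y → ℝ}
    (hF : Integrable F (μ.prod ν)) :
    ∫ x, ‖∫ y, F (x, y) ∂ν‖ ∂μ ≤ ∫ p, ‖F p‖ ∂(μ.prod ν) := by
  rw [integral_prod _ hF.norm]
  exact integral_mono hF.integral_prod_left.norm hF.norm.integral_prod_left
    fun x => norm_integral_le_integral_norm _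

/-- The angular average of `φ(v') + φ(v'_*) - φ(v) - φ(v_*)` against the collision kernel. -/
def collisionGain (β : ℝ) (h : ℝ → ℝ) (φ : V d → ℝ) (v w : V d) : ℝ :=
  ∫ σ, (φ (vPrime v w σ) + φ (vPrimeStar v w σ) - φ v - φ w) * kernel β h (v - w) σ ∂(surface d)

/-- The weak form of the collision operator. -/
theorem weak_form (hd : 2 ≤ d) (H : IsAngularKernel d h A) (hβ : 0 < β) (hβ1 : β ≤ 1)
    {g : V d → ℝ} (hg : Measurable g) {k : ℕ}
    (hgi : Integrable (fun v => |g v| * (1 + ‖v‖ ^ 2) ^ (k + 1)))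
    {φ : V d → ℝ} (hφ : Measurable φ) {C : ℝ} (hC0 : 0 ≤ C)
    (hC : ∀ v, |φ v| ≤ C * (1 + ‖v‖ ^ 2) ^ k) :
    Integrable (fun v => φ v * collision (kernel β h) g v) ∧
    ∫ v, |φ v * collision (kernel β h) g v|
      ≤ 4 * A * C * (∫ v, |g v| * (1 + ‖v‖ ^ 2) ^ (k + 1)) ^ 2 ∧
    Integrable (fun z : V d × V d => g z.1 * g z.2 * collisionGain β h φ z.1 z.2)
      ((volume : Measure (V d)).prod volume) ∧
    ∫ v, φ v * collision (kernel β h) g v = 1 / 2 * ∫ z : V d × V d,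
      g z.1 * g z.2 * collisionGain β h φ z.1 z.2 ∂((volume : Measure (V d)).prod volume) := by
  have hA := H.mass_nonneg hd
  have hm1 := measurable_vPrime (d := d)
  have hm2 := measurable_vPrimeStar (d := d)
  have hw : ∀ v w : V d, (1 + ‖v‖ ^ 2) ≤ (1 + ‖v‖ ^ 2) * (1 + ‖w‖ ^ 2) := fun v w => by
    nlinarith [mul_nonneg (sq_nonneg ‖v‖) (sq_nonneg ‖w‖), sq_nonneg ‖w‖]
  have hw' : ∀ v w : V d, (1 + ‖w‖ ^ 2) ≤ (1 + ‖v‖ ^ 2) * (1 + ‖w‖ ^ 2) := fun v w => by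
    nlinarith [mul_nonneg (sq_nonneg ‖v‖) (sq_nonneg ‖w‖), sq_nonneg ‖v‖]
  have J := fun (q : (V d × V d) × S d → ℝ) (hq : Measurable q)
    (hqC : ∀ p, |q p| ≤ C * ((1 + ‖p.1.1‖ ^ 2) * (1 + ‖p.1.2‖ ^ 2)) ^ k) =>
    integrable_collision H hA hβ hβ1 hg hgi hq hC0 hqC
  have J1 := J (fun p => φ p.1.1) (by fun_prop) fun p => (hC _).trans (by
    gcongr; exact hw _ _)
  have J2 := J (fun p => φ p.1.2) (by fun_prop) fun p => (hC _).trans (by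
    gcongr; exact hw' _ _)
  have J3 := J (fun p => φ (vPrime p.1.1 p.1.2 p.2)) (by fun_prop) fun p => (hC _).trans (by
    gcongr; exact one_add_norm_sq_vPrime_le _ _ _)
  have J4 := J (fun p => φ (vPrimeStar p.1.1 p.1.2 p.2)) (by fun_prop) fun p => (hC _).trans (by
    gcongr; exact one_add_norm_sq_vPrimeStar_le _ _ _)
  have E1 := integral_prePost hd hβ H.measurable (Ψ := fun q => g q.1 * g q.2.1 * φ q.2.2.1)
    (by fun_prop)
  have E1' := integral_prePost hd hβ H.measurable (Ψ := fun q => ‖g q.1 * g q.2.1 * φ q.2.2.1‖)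
    (by fun_prop)
  have E2 := (integral_exchange hβ H.measurable (Ψ := fun q => g q.1 * g q.2.1 * φ q.2.2.1)
    (by fun_prop)).2
  have E3 := (integral_exchange hβ H.measurable (Ψ := fun q => g q.1 * g q.2.1 * φ q.1)
    (by fun_prop)).2
  dsimp only at E1 E1' E2 E3
  have J5 := E1.1.2 J3.1
  have hnn : ∀ (a : ℝ) (u : V d) (σ : S d),
      ‖a‖ * kernel β h u σ = ‖a * kernel β h u σ‖ := fun a u σ => by
    rw [norm_mul, Real.norm_of_nonneg (H.kernel_nonneg u σ)]
  simp only [hnn] at E1'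
  -- the full integrand
  set Z : (V d × V d) × S d → ℝ := fun p => φ p.1.1 *
    ((g (vPrimeStar p.1.1 p.1.2 p.2) * g (vPrime p.1.1 p.1.2 p.2) - g p.1.2 * g p.1.1)
      * kernel β h (p.1.1 - p.1.2) p.2) with hZ
  have hZ' : Z = fun p => g (vPrime p.1.1 p.1.2 p.2) * g (vPrimeStar p.1.1 p.1.2 p.2) * φ p.1.1
      * kernel β h (p.1.1 - p.1.2) p.2 - g p.1.1 * g p.1.2 * φ p.1.1
      * kernel β h (p.1.1 - p.1.2) p.2 := by
    ext p; simp only [hZ]; ring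
  have hZi : Integrable Z (collisionMeasure d) := by rw [hZ']; exact J5.sub J1.1
  have hcol : ∀ v, ∫ w, ∫ σ, Z ((v, w), σ) ∂(surface d) = φ v * collision (kernel β h) g v := by
    intro v
    simp only [hZ, collision, integral_const_mul]
  have hZ2 := hZi.integral_prod_left
  have hG : (fun z : V d × V d => g z.1 * g z.2 * collisionGain β h φ z.1 z.2) = fun z =>
      ∫ σ, (g z.1 * g z.2 * φ (vPrime z.1 z.2 σ) * kernel β h (z.1 - z.2) σ
        + g z.1 * g z.2 * φ (vPrimeStar z.1 z.2 σ) * kernel β h (z.1 - z.2) σ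
        - g z.1 * g z.2 * φ z.1 * kernel β h (z.1 - z.2) σ
        - g z.1 * g z.2 * φ z.2 * kernel β h (z.1 - z.2) σ) ∂(surface d) := by
    ext z
    rw [collisionGain, ← integral_const_mul]
    congr 1 with σ
    ring
  have hGi := ((J3.1.add J4.1).sub J1.1).sub J2.1
  refine ⟨?_, ?_, ?_, ?_⟩
  · have := hZ2.integral_prod_left
    simpa only [hcol] using this
  · have h1 := integral_norm_integral_le hZ2
    have h2 := integral_norm_integral_le hZi
    simp only [hcol, Real.norm_eq_abs] at h1
    refine h1.trans (h2.trans ?_)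
    have h3 : ∫ p, ‖Z p‖ ∂(collisionMeasure d) ≤
        ∫ p : (V d × V d) × S d, (‖g (vPrime p.1.1 p.1.2 p.2) * g (vPrimeStar p.1.1 p.1.2 p.2)
          * φ p.1.1 * kernel β h (p.1.1 - p.1.2) p.2‖ + ‖g p.1.1 * g p.1.2 * φ p.1.1
          * kernel β h (p.1.1 - p.1.2) p.2‖) ∂(collisionMeasure d) := by
      refine integral_mono hZi.norm (J5.norm.add J1.1.norm) fun p => ?_
      rw [hZ']
      exact norm_sub_le _ _
    refine h3.trans ?_
    rw [integral_add J5.norm J1.1.norm, E1'.2]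
    linarith [J3.2, J1.2]
  · rw [hG]
    exact hGi.integral_prod_left
  · have hGe := integral_prod _ hGi
    simp only [Pi.add_apply, Pi.sub_apply] at hGe
    rw [hG, ← hGe]
    simp only [← hcol]
    rw [← integral_prod _ hZ2, ← integral_prod _ hZi]
    -- Microreversibility moves the test function of the gain term to v', leaving φ(v') − φ(v).
    -- Averaging with the version in which the particles are exchanged gives the four-term sum and
    -- the factor 1/2.
    rw [hZ', integral_sub J5 J1.1, E1.2]
    have e := integral_sub ((J3.1.add J4.1).sub J1.1) J2.1
    rw [integral_sub' (J3.1.add J4.1) J1.1, integral_add' J3.1 J4.1] at e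
    have e4 : ∫ p : (V d × V d) × S d, g p.1.1 * g p.1.2 * φ (vPrimeStar p.1.1 p.1.2 p.2)
        * kernel β h (p.1.1 - p.1.2) p.2 ∂(collisionMeasure d)
        = ∫ p : (V d × V d) × S d, g p.1.1 * g p.1.2 * φ (vPrime p.1.1 p.1.2 p.2)
        * kernel β h (p.1.1 - p.1.2) p.2 ∂(collisionMeasure d) := by
      rw [← E2]; congr 1 with p; ring
    have e2 : ∫ p : (V d × V d) × S d, g p.1.1 * g p.1.2 * φ p.1.2
        * kernel β h (p.1.1 - p.1.2) p.2 ∂(collisionMeasure d)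
        = ∫ p : (V d × V d) × S d, g p.1.1 * g p.1.2 * φ p.1.1
        * kernel β h (p.1.1 - p.1.2) p.2 ∂(collisionMeasure d) := by
      rw [← E3]; congr 1 with p; ring
    rw [e4, e2] at e
    simp only [Pi.add_apply, Pi.sub_apply] at e
    rw [e]
    ring

end

section

variable {d : ℕ} {h : ℝ → ℝ} {A β : ℝ}

theorem integrable_mul_of_moment {g : V d → ℝ} (hg : Measurable g) {k : ℕ}
    (hgi : Integrable (fun v => |g v| * (1 + ‖v‖ ^ 2) ^ k)) {q : V d → ℝ} (hq : Measurable q)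
    {C : ℝ} (hC : ∀ v, |q v| ≤ C * (1 + ‖v‖ ^ 2) ^ k) : Integrable (fun v => g v * q v) := by
  refine (hgi.const_mul C).mono' (by fun_prop) (.of_forall fun v => ?_)
  rw [norm_mul, Real.norm_eq_abs, Real.norm_eq_abs]
  calc |g v| * |q v| ≤ |g v| * (C * (1 + ‖v‖ ^ 2) ^ k) := by gcongr; exact hC v
    _ = _ := by ring

theorem moment_mono {g : V d → ℝ} (hg : Measurable g) {k l : ℕ} (hkl : k ≤ l)
    (hgi : Integrable (fun v => |g v| * (1 + ‖v‖ ^ 2) ^ l)) :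
    Integrable (fun v => |g v| * (1 + ‖v‖ ^ 2) ^ k) := by
  refine hgi.mono' (by fun_prop) (.of_forall fun v => ?_)
  rw [Real.norm_of_nonneg (by positivity)]
  gcongr
  nlinarith [sq_nonneg ‖v‖]

theorem stronglyMeasurable_collision (hh : Measurable h) {f : V d → ℝ → ℝ}
    (hf : Measurable (fun p : V d × ℝ => f p.1 p.2)) :
    StronglyMeasurable
      (fun p : ℝ × V d => collision (kernel β h) (fun w => f w p.1) p.2) := by
  have hf' : ∀ {X : Type} [MeasurableSpace X] {a : X → V d} {b : X → ℝ}, Measurable a →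
      Measurable b → Measurable (fun x => f (a x) (b x)) := fun ha hb => hf.comp (ha.prodMk hb)
  have h1 : Measurable (fun p : ((ℝ × V d) × V d) × S d =>
      (f (vPrimeStar p.1.1.2 p.1.2 p.2) p.1.1.1 * f (vPrime p.1.1.2 p.1.2 p.2) p.1.1.1
        - f p.1.2 p.1.1.1 * f p.1.1.2 p.1.1.1) * kernel β h (p.1.1.2 - p.1.2) p.2) := by
    refine Measurable.mul (Measurable.sub (Measurable.mul ?_ ?_) (Measurable.mul ?_ ?_)) ?_
    · exact hf' (by unfold vPrimeStar; fun_prop) (by fun_prop)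
    · exact hf' (by unfold vPrime; fun_prop) (by fun_prop)
    · exact hf' (by fun_prop) (by fun_prop)
    · exact hf' (by fun_prop) (by fun_prop)
    · unfold kernel; fun_prop
  have h2 := (h1.stronglyMeasurable.integral_prod_right' (ν := surface d)).integral_prod_right'
    (ν := (volume : Measure (V d)))
  exact h2

/-- The weak form of the equation, integrated in time, for test functions of polynomial growth. -/
theorem IsMildSolution.integral_sub_eq (hd : 2 ≤ d) (H : IsAngularKernel d h A) (hβ : 0 < β)
    (hβ1 : β ≤ 1) {f₀ : V d → ℝ} {f : V d → ℝ → ℝ} (hf : IsMildSolution (kernel β h) f₀ f)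
    {s t : ℝ} (hs : 0 ≤ s) (hst : s ≤ t) {k : ℕ} {N : ℝ}
    (hN : ∀ τ ∈ Icc s t, Integrable (fun v => |f v τ| * (1 + ‖v‖ ^ 2) ^ (k + 1)) ∧
      ∫ v, |f v τ| * (1 + ‖v‖ ^ 2) ^ (k + 1) ≤ N)
    {φ : V d → ℝ} (hφ : Measurable φ) {C : ℝ} (hC0 : 0 ≤ C)
    (hC : ∀ v, |φ v| ≤ C * (1 + ‖v‖ ^ 2) ^ k) :
    IntervalIntegrable (fun τ => ∫ v, φ v * collision (kernel β h) (fun w => f w τ) v)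
      volume s t ∧
    (∫ v, f v t * φ v) - (∫ v, f v s * φ v)
      = ∫ τ in s..t, ∫ v, φ v * collision (kernel β h) (fun w => f w τ) v := by
  have hA := H.mass_nonneg hd
  have hfm : ∀ τ, Measurable (fun v => f v τ) := fun τ =>
    hf.measurable.comp (measurable_id.prodMk measurable_const)
  set F : ℝ → V d → ℝ := fun τ v => φ v * collision (kernel β h) (fun w => f w τ) v with hF
  have hFm : StronglyMeasurable (Function.uncurry F) := by
    have := stronglyMeasurable_collision (β := β) H.measurable hf.measurable
    exact (hφ.comp measurable_snd).stronglyMeasurable.mul this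
  have hmem : ∀ᵐ τ ∂(volume.restrict (Ioc s t)), τ ∈ Ioc s t := ae_restrict_mem measurableSet_Ioc
  have hFi : Integrable (Function.uncurry F) ((volume.restrict (Ioc s t)).prod volume) := by
    refine (integrable_prod_iff hFm.aestronglyMeasurable).2 ⟨?_, ?_⟩
    · filter_upwards [hmem] with τ hτ
      exact (weak_form hd H hβ hβ1 (hfm τ) (hN τ (Ioc_subset_Icc_self hτ)).1 hφ hC0 hC).1
    · refine Integrable.of_bound (C := 4 * A * C * N ^ 2)
        (hFm.norm.integral_prod_right').aestronglyMeasurable ?_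
      filter_upwards [hmem] with τ hτ
      have hτ' := Ioc_subset_Icc_self hτ
      rw [Real.norm_of_nonneg (integral_nonneg fun _ => norm_nonneg _)]
      refine (weak_form hd H hβ hβ1 (hfm τ) (hN τ hτ').1 hφ hC0 hC).2.1.trans ?_
      have h0 : 0 ≤ ∫ v, |f v τ| * (1 + ‖v‖ ^ 2) ^ (k + 1) :=
        integral_nonneg fun v => by positivity
      gcongr
      exact (hN τ hτ').2
  refine ⟨?_, ?_⟩
  · rw [intervalIntegrable_iff_integrableOn_Ioc_of_le hst]
    exact hFi.integral_prod_left
  · have hsw := intervalIntegral_integral_swap (a := s) (b := t) (f := F)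
      (by rw [uIoc_of_le hst]; exact hFi)
    have hint : ∀ τ ∈ Icc s t, Integrable (fun v => f v τ * φ v) := fun τ hτ =>
      integrable_mul_of_moment (hfm τ) (moment_mono (hfm τ) k.le_succ (hN τ hτ).1) hφ hC
    rw [hsw, ← integral_sub (hint t ⟨hst, le_rfl⟩) (hint s ⟨le_rfl, hst⟩)]
    refine integral_congr_ae ?_
    filter_upwards [hf.mild] with v hv
    rcases hst.eq_or_lt with rfl | hlt
    · simp
    · simp only [hF, intervalIntegral.integral_const_mul]
      rw [← (hv.2 s t hs hlt).2]
      ring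

theorem integrable_gain (H : IsAngularKernel d h A) (hβ : 0 < β) {φ : V d → ℝ}
    (hφ : Measurable φ) {k : ℕ} {C : ℝ} (hC0 : 0 ≤ C) (hC : ∀ v, |φ v| ≤ C * (1 + ‖v‖ ^ 2) ^ k)
    (v w : V d) :
    Integrable (fun σ => φ (vPrime v w σ) * kernel β h (v - w) σ) (surface d) ∧
    Integrable (fun σ => φ (vPrimeStar v w σ) * kernel β h (v - w) σ) (surface d) := by
  have m1 : Measurable (fun σ : S d => vPrime v w σ) := by unfold vPrime; fun_prop
  have m2 : Measurable (fun σ : S d => vPrimeStar v w σ) := by unfold vPrimeStar; fun_prop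
  constructor
  · refine (H.integrable_kernel hβ (v - w)).bdd_mul
      (c := C * ((1 + ‖v‖ ^ 2) * (1 + ‖w‖ ^ 2)) ^ k) (hφ.comp m1).aestronglyMeasurable (.of_forall fun σ => ?_)
    refine (hC _).trans ?_
    gcongr
    exact one_add_norm_sq_vPrime_le v w σ
  · refine (H.integrable_kernel hβ (v - w)).bdd_mul
      (c := C * ((1 + ‖v‖ ^ 2) * (1 + ‖w‖ ^ 2)) ^ k) (hφ.comp m2).aestronglyMeasurable (.of_forall fun σ => ?_)
    refine (hC _).trans ?_
    gcongr
    exact one_add_norm_sq_vPrimeStar_le v w σ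

theorem collisionGain_eq (H : IsAngularKernel d h A) (hβ : 0 < β) {φ : V d → ℝ}
    (hφ : Measurable φ) {k : ℕ} {C : ℝ} (hC0 : 0 ≤ C) (hC : ∀ v, |φ v| ≤ C * (1 + ‖v‖ ^ 2) ^ k)
    (v w : V d) :
    collisionGain β h φ v w
      = ∫ σ, (φ (vPrime v w σ) + φ (vPrimeStar v w σ)) * kernel β h (v - w) σ ∂(surface d)
        - A * ‖v - w‖ ^ β * (φ v + φ w) := by
  obtain ⟨i1, i2⟩ := integrable_gain H hβ hφ hC0 hC v w
  have i3 := (H.integrable_kernel hβ (v - w)).const_mul (φ v + φ w)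
  have e : ∀ σ, (φ (vPrime v w σ) + φ (vPrimeStar v w σ) - φ v - φ w) * kernel β h (v - w) σ
      = (φ (vPrime v w σ) + φ (vPrimeStar v w σ)) * kernel β h (v - w) σ
        - (φ v + φ w) * kernel β h (v - w) σ := fun σ => by ring
  have i12 : Integrable (fun σ =>
      (φ (vPrime v w σ) + φ (vPrimeStar v w σ)) * kernel β h (v - w) σ) (surface d) := by
    exact (i1.add i2).congr (.of_forall fun σ => (add_mul _ _ _).symm)
  rw [collisionGain]
  simp only [e]
  rw [integral_sub i12 i3, integral_const_mul, H.integral_kernel hβ]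
  ring

/-- An upper bound for the weak collision operator through a bound of the collision gain. -/
theorem integral_mul_collision_le (hd : 2 ≤ d) (H : IsAngularKernel d h A) (hβ : 0 < β)
    (hβ1 : β ≤ 1) {g : V d → ℝ} (hg : Measurable g) (hg0 : ∀ᵐ v, 0 ≤ g v) {k : ℕ}
    (hgi : Integrable (fun v => |g v| * (1 + ‖v‖ ^ 2) ^ (k + 1)))
    {φ : V d → ℝ} (hφ : Measurable φ) {C : ℝ} (hC0 : 0 ≤ C)
    (hC : ∀ v, |φ v| ≤ C * (1 + ‖v‖ ^ 2) ^ k) {b : V d → V d → ℝ}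
    (hb : ∀ v w, collisionGain β h φ v w ≤ b v w)
    (hbi : Integrable (fun z : V d × V d => g z.1 * g z.2 * b z.1 z.2)
      ((volume : Measure (V d)).prod volume)) :
    ∫ v, φ v * collision (kernel β h) g v ≤ 1 / 2 * ∫ z : V d × V d, g z.1 * g z.2 * b z.1 z.2
      ∂((volume : Measure (V d)).prod volume) := by
  obtain ⟨-, -, hi, he⟩ := weak_form hd H hβ hβ1 hg hgi hφ hC0 hC
  rw [he]
  gcongr 1 / 2 * ?_
  refine integral_mono_ae hi hbi ?_
  have a1 := (Measure.quasiMeasurePreserving_fst (μ := (volume : Measure (V d)))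
    (ν := (volume : Measure (V d)))).ae hg0
  have a2 := (Measure.quasiMeasurePreserving_snd (μ := (volume : Measure (V d)))
    (ν := (volume : Measure (V d)))).ae hg0
  filter_upwards [a1, a2] with z h1 h2
  exact mul_le_mul_of_nonneg_left (hb _ _) (mul_nonneg h1 h2)

/-- Removes truncations: a bound uniform in the truncation passes to the limiting weight together
with integrability. It serves both the polynomial and the Gaussian moments. -/
theorem fatou_bound {X : Type*} [MeasurableSpace X] {μ : Measure X} {F : ℕ → X → ℝ} {G : X → ℝ}
    {K : ℝ} (hF : ∀ n, Integrable (F n) μ) (hF0 : ∀ n, ∀ᵐ x ∂μ, 0 ≤ F n x)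
    (hK : ∀ᶠ n in atTop, ∫ x, F n x ∂μ ≤ K)
    (hG : ∀ᵐ x ∂μ, Tendsto (fun n => F n x) atTop (𝓝 (G x))) :
    Integrable G μ ∧ ∫ x, G x ∂μ ≤ K := by
  have hGm : AEStronglyMeasurable G μ :=
    aestronglyMeasurable_of_tendsto_ae atTop (fun n => (hF n).aestronglyMeasurable) hG
  have hG0 : 0 ≤ᵐ[μ] G := by
    filter_upwards [hG, ae_all_iff.2 hF0] with x hx h0
    exact ge_of_tendsto' hx h0
  have hK0 : 0 ≤ K := by
    obtain ⟨n, hn⟩ := hK.exists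
    exact (integral_nonneg_of_ae (hF0 n)).trans hn
  have key : ∫⁻ x, ENNReal.ofReal (G x) ∂μ ≤ ENNReal.ofReal K := by
    calc ∫⁻ x, ENNReal.ofReal (G x) ∂μ
        = ∫⁻ x, liminf (fun n => ENNReal.ofReal (F n x)) atTop ∂μ := by
          refine lintegral_congr_ae ?_
          filter_upwards [hG] with x hx
          exact ((ENNReal.continuous_ofReal.tendsto _).comp hx).liminf_eq.symm
      _ ≤ liminf (fun n => ∫⁻ x, ENNReal.ofReal (F n x) ∂μ) atTop :=
          lintegral_liminf_le' fun n => (hF n).aestronglyMeasurable.aemeasurable.ennreal_ofReal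
      _ ≤ ENNReal.ofReal K := by
          refine liminf_le_of_frequently_le' (Eventually.frequently ?_)
          filter_upwards [hK] with n hn
          rw [← ofReal_integral_eq_lintegral_ofReal (hF n) (hF0 n)]
          exact ENNReal.ofReal_le_ofReal hn
  have hGi : Integrable G μ := by
    refine ⟨hGm, ?_⟩
    rw [hasFiniteIntegral_iff_ofReal hG0]
    exact key.trans_lt ENNReal.ofReal_lt_top
  refine ⟨hGi, ?_⟩
  rw [← ofReal_integral_eq_lintegral_ofReal hGi hG0] at key
  exact (ENNReal.ofReal_le_ofReal_iff hK0).1 key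

end

/-! ### Truncated powers and a Gronwall inequality -/

section

variable {d : ℕ} {h : ℝ → ℝ} {A β : ℝ}

/-- The primitive of `s ↦ min s R ^ q`: a convex function of linear growth which agrees with
`r ^ (q + 1) / (q + 1)` up to `R`. -/
def truncPow (R : ℝ) (q : ℕ) (r : ℝ) : ℝ := ∫ s in (0 : ℝ)..r, min s R ^ q

theorem continuous_min_pow (R : ℝ) (q : ℕ) : Continuous (fun s : ℝ => min s R ^ q) := by fun_prop

theorem continuous_truncPow (R : ℝ) (q : ℕ) : Continuous (truncPow R q) :=
  intervalIntegral.continuous_primitive (fun _ _ => (continuous_min_pow R q).intervalIntegrable _ _) 0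

theorem truncPow_sub (R : ℝ) (q : ℕ) (x y : ℝ) :
    truncPow R q y - truncPow R q x = ∫ s in x..y, min s R ^ q :=
  intervalIntegral.integral_interval_sub_left ((continuous_min_pow R q).intervalIntegrable _ _)
    ((continuous_min_pow R q).intervalIntegrable _ _)

@[simp] theorem truncPow_zero (R : ℝ) (q : ℕ) : truncPow R q 0 = 0 := by simp [truncPow]

theorem truncPow_sub_le {R : ℝ} (hR : 0 ≤ R) (q : ℕ) {x y : ℝ} (hx : 0 ≤ x) (hxy : x ≤ y) :
    truncPow R q y - truncPow R q x ≤ (y - x) * min y R ^ q := by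
  rw [truncPow_sub]
  have := intervalIntegral.integral_mono_on (μ := volume) hxy ((continuous_min_pow R q).intervalIntegrable x y)
    (_root_.intervalIntegrable_const (c := min y R ^ q)) (fun s hs => by
      have h0 : 0 ≤ min s R := le_min (hx.trans hs.1) hR
      have := min_le_min_right R hs.2
      gcongr)
  simpa using this

theorem le_truncPow_sub {R : ℝ} (hR : 0 ≤ R) (q : ℕ) {x y : ℝ} (hx : 0 ≤ x) (hxy : x ≤ y) :
    (y - x) * min x R ^ q ≤ truncPow R q y - truncPow R q x := by
  rw [truncPow_sub]
  have := intervalIntegral.integral_mono_on (μ := volume) hxy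
    (_root_.intervalIntegrable_const (c := min x R ^ q))
    ((continuous_min_pow R q).intervalIntegrable x y) (fun s hs => by
      have h0 : 0 ≤ min x R := le_min hx hR
      have := min_le_min_right R hs.1
      gcongr)
  simpa using this

theorem truncPow_mono {R : ℝ} (hR : 0 ≤ R) (q : ℕ) {x y : ℝ} (hx : 0 ≤ x) (hxy : x ≤ y) :
    truncPow R q x ≤ truncPow R q y := by
  have h0 : 0 ≤ min x R := le_min hx hR
  have := le_truncPow_sub hR q hx hxy
  have : 0 ≤ (y - x) * min x R ^ q := mul_nonneg (by linarith) (by positivity)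
  linarith

theorem truncPow_nonneg {R : ℝ} (hR : 0 ≤ R) (q : ℕ) {x : ℝ} (hx : 0 ≤ x) :
    0 ≤ truncPow R q x := by
  simpa using truncPow_mono hR q le_rfl hx

/-- The integrand is nondecreasing on [0, ∞), so its integral over [x, x + y] is at least that over
[0, y]. -/
theorem truncPow_add_le {R : ℝ} (hR : 0 ≤ R) (q : ℕ) {x y : ℝ} (hx : 0 ≤ x) (hy : 0 ≤ y) :
    truncPow R q x + truncPow R q y ≤ truncPow R q (x + y) := by
  have h1 : truncPow R q (x + y) - truncPow R q x = ∫ s in (0 : ℝ)..y, min (s + x) R ^ q := by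
    rw [truncPow_sub, intervalIntegral.integral_comp_add_right (fun s => min s R ^ q), zero_add,
      add_comm y]
  have h2 : truncPow R q y ≤ ∫ s in (0 : ℝ)..y, min (s + x) R ^ q := by
    refine intervalIntegral.integral_mono_on hy ((continuous_min_pow R q).intervalIntegrable _ _)
      (Continuous.intervalIntegrable (by fun_prop) _ _) fun s hs => ?_
    have h0 : 0 ≤ min s R := le_min hs.1 hR
    have : min s R ≤ min (s + x) R := min_le_min_right R (by linarith)
    gcongr
  linarith

theorem truncPow_eq {R : ℝ} (q : ℕ) {r : ℝ} (hr : 0 ≤ r) (hrR : r ≤ R) :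
    truncPow R q r = r ^ (q + 1) / (q + 1) := by
  have : truncPow R q r = ∫ s in (0 : ℝ)..r, s ^ q := by
    refine intervalIntegral.integral_congr fun s hs => ?_
    rw [uIcc_of_le hr] at hs
    simp only [min_eq_left (hs.2.trans hrR)]
  rw [this, integral_pow]
  simp

theorem truncPow_le_pow {R : ℝ} (hR : 0 ≤ R) (q : ℕ) {r : ℝ} (hr : 0 ≤ r) :
    truncPow R q r ≤ r ^ (q + 1) := by
  have h1 := truncPow_sub_le hR q le_rfl hr
  simp only [truncPow_zero, sub_zero] at h1
  refine h1.trans ?_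
  rw [pow_succ']
  have h0 : 0 ≤ min r R := le_min hr hR
  gcongr
  exact min_le_left _ _

/-- Subtracting the asymptotic slope leaves a bounded function, admissible in the weak form with
mass and energy alone. The subtracted multiple of the energy is a collision invariant. -/
theorem abs_truncPow_sub_linear_le {R : ℝ} (hR : 0 ≤ R) (q : ℕ) {r : ℝ} (hr : 0 ≤ r) :
    |truncPow R q r - R ^ q * r| ≤ R ^ (q + 1) := by
  have h0 : 0 ≤ min r R := le_min hr hR
  rw [abs_le]
  constructor
  · rcases le_total r R with h1 | h1
    · have := truncPow_nonneg hR q hr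
      have : R ^ q * r ≤ R ^ (q + 1) := by rw [pow_succ]; gcongr
      linarith
    · have h2 := le_truncPow_sub hR q hR h1
      have h3 := truncPow_nonneg hR q hR
      rw [min_self] at h2
      rw [pow_succ]
      linarith
  · have h1 := truncPow_sub_le hR q le_rfl hr
    simp only [truncPow_zero, sub_zero] at h1
    have : r * min r R ^ q ≤ r * R ^ q := by
      gcongr
      exact min_le_right _ _
    have : 0 ≤ R ^ (q + 1) := by positivity
    linarith

theorem min_two_mul_pow_le {R : ℝ} (hR : 0 ≤ R) (q : ℕ) {x : ℝ} (hx : 0 ≤ x) :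
    min (2 * x) R ^ q ≤ 2 ^ q * min x R ^ q := by
  rw [← mul_pow]
  have h0 : 0 ≤ min (2 * x) R := le_min (by linarith) hR
  have : min (2 * x) R ≤ 2 * min x R := by
    rcases le_total x R with h1 | h1
    · rw [min_eq_left h1]; exact min_le_left _ _
    · rw [min_eq_right h1]; exact (min_le_right _ _).trans (by linarith)
  gcongr

/-- A doubling estimate: the interval [x/2, x] alone contributes a fixed fraction of `x * min x R ^
q`, independently of R. -/
theorem mul_min_pow_le_truncPow {R : ℝ} (hR : 0 ≤ R) (q : ℕ) {x : ℝ} (hx : 0 ≤ x) :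
    x * min x R ^ q ≤ 2 ^ (q + 1) * truncPow R q x := by
  have h1 := le_truncPow_sub hR q (x := x / 2) (y := x) (by linarith) (by linarith)
  have h2 := truncPow_nonneg hR q (x := x / 2) (by linarith)
  have h3 := min_two_mul_pow_le hR q (x := x / 2) (by linarith)
  rw [show 2 * (x / 2) = x by ring] at h3
  calc x * min x R ^ q ≤ x * (2 ^ q * min (x / 2) R ^ q) := by gcongr
    _ = 2 ^ (q + 1) * ((x - x / 2) * min (x / 2) R ^ q) := by ring
    _ ≤ 2 ^ (q + 1) * truncPow R q x := by gcongr; linarith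

theorem mul_truncPow_sub_le {R : ℝ} (hR : 0 ≤ R) (q : ℕ) {x y : ℝ} (hy : 0 ≤ y) (hyx : y ≤ x) :
    x * (truncPow R q (x + y) - truncPow R q x) ≤ 2 ^ (2 * q + 1) * (y * truncPow R q x) := by
  have hx := hy.trans hyx
  have h1 := truncPow_sub_le hR q hx (show x ≤ x + y by linarith)
  have h0 : 0 ≤ min (x + y) R := le_min (by linarith) hR
  have h2 : min (x + y) R ^ q ≤ 2 ^ q * min x R ^ q := by
    refine le_trans ?_ (min_two_mul_pow_le hR q hx)
    have : min (x + y) R ≤ min (2 * x) R := min_le_min_right R (by linarith)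
    gcongr
  calc x * (truncPow R q (x + y) - truncPow R q x)
      ≤ x * ((x + y - x) * min (x + y) R ^ q) := by gcongr
    _ = x * y * min (x + y) R ^ q := by ring
    _ ≤ x * y * (2 ^ q * min x R ^ q) := by gcongr
    _ = y * 2 ^ q * (x * min x R ^ q) := by ring
    _ ≤ y * 2 ^ q * (2 ^ (q + 1) * truncPow R q x) := by
        exact mul_le_mul_of_nonneg_left (mul_min_pow_le_truncPow hR q hx) (by positivity)
    _ = _ := by ring

/-- The increment from x to x + y is at most a constant times (y/x) times the truncated power at x,
by doubling. For |v| ≥ 1 the kernel factor, at most 2|v|^β ≤ 2x, cancels the 1/x; for |v| ≤ 1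
everything but y is bounded, whence the extra 1. The constant does not depend on R. -/
theorem norm_rpow_mul_truncPow_le_of_le (hβ : 0 < β) (hβ1 : β ≤ 1) {R : ℝ} (hR : 0 ≤ R) (q : ℕ)
    {v w : V d} (hwv : ‖w‖ ≤ ‖v‖) :
    ‖v - w‖ ^ β * (truncPow R q (‖v‖ ^ 2 + ‖w‖ ^ 2) - truncPow R q (‖v‖ ^ 2)
        - truncPow R q (‖w‖ ^ 2))
      ≤ 2 ^ (2 * q + 2) * (‖w‖ ^ 2 * (1 + truncPow R q (‖v‖ ^ 2))) := by
  set x := ‖v‖ ^ 2 with hx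
  set y := ‖w‖ ^ 2 with hy
  have hy0 : 0 ≤ y := sq_nonneg _
  have hx0 : 0 ≤ x := sq_nonneg _
  have hyx : y ≤ x := by simp only [hx, hy]; gcongr
  have hpx := truncPow_nonneg hR q hx0
  have hpy := truncPow_nonneg hR q hy0
  have hD0 : 0 ≤ truncPow R q (x + y) - truncPow R q x := by
    linarith [truncPow_mono hR q hx0 (show x ≤ x + y by linarith)]
  have hu : ‖v - w‖ ^ β ≤ 2 * ‖v‖ ^ β := by
    have h1 := norm_sub_rpow_le hβ hβ1 v w
    have h2 := Real.rpow_le_rpow (norm_nonneg w) hwv hβ.le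
    linarith
  have h1 : ‖v - w‖ ^ β * (truncPow R q (x + y) - truncPow R q x - truncPow R q y)
      ≤ 2 * ‖v‖ ^ β * (truncPow R q (x + y) - truncPow R q x) :=
    calc _ ≤ ‖v - w‖ ^ β * (truncPow R q (x + y) - truncPow R q x) := by
          exact mul_le_mul_of_nonneg_left (by linarith) (by positivity)
      _ ≤ _ := by gcongr
  refine h1.trans ?_
  rcases le_total 1 ‖v‖ with h2 | h2
  · have h3 : ‖v‖ ^ β ≤ x := by
      rw [hx, ← Real.rpow_two]
      exact Real.rpow_le_rpow_of_exponent_le h2 (by linarith)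
    have h4 := mul_truncPow_sub_le hR q hy0 hyx
    calc 2 * ‖v‖ ^ β * (truncPow R q (x + y) - truncPow R q x)
        ≤ 2 * x * (truncPow R q (x + y) - truncPow R q x) := by gcongr
      _ ≤ 2 * (2 ^ (2 * q + 1) * (y * truncPow R q x)) := by linarith
      _ = 2 ^ (2 * q + 2) * (y * truncPow R q x) := by ring
      _ ≤ _ := by gcongr; linarith
  · have h3 : ‖v‖ ^ β ≤ 1 := Real.rpow_le_one (norm_nonneg _) h2 hβ.le
    have h4 := truncPow_sub_le hR q hx0 (show x ≤ x + y by linarith)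
    have hx1 : x ≤ 1 := by rw [hx]; exact pow_le_one₀ (norm_nonneg _) h2
    have h0 : 0 ≤ min (x + y) R := le_min (by linarith) hR
    have h5 : min (x + y) R ^ q ≤ 2 ^ q := by
      have : min (x + y) R ≤ 2 := (min_le_left _ _).trans (by linarith)
      gcongr
    have h6 : 1 ≤ 1 + truncPow R q x := by linarith
    calc 2 * ‖v‖ ^ β * (truncPow R q (x + y) - truncPow R q x)
        ≤ 2 * 1 * ((x + y - x) * 2 ^ q) := by
          gcongr
          exact h4.trans (by rw [add_sub_cancel_left]; gcongr)
      _ = 2 ^ (q + 1) * (y * 1) := by ring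
      _ ≤ 2 ^ (2 * q + 2) * (y * (1 + truncPow R q x)) := by
          gcongr
          · norm_num
          · omega
          · linarith

theorem norm_rpow_mul_truncPow_le (hβ : 0 < β) (hβ1 : β ≤ 1) {R : ℝ} (hR : 0 ≤ R) (q : ℕ)
    (v w : V d) :
    ‖v - w‖ ^ β * (truncPow R q (‖v‖ ^ 2 + ‖w‖ ^ 2) - truncPow R q (‖v‖ ^ 2)
        - truncPow R q (‖w‖ ^ 2))
      ≤ 2 ^ (2 * q + 2) * (‖w‖ ^ 2 * (1 + truncPow R q (‖v‖ ^ 2))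
        + ‖v‖ ^ 2 * (1 + truncPow R q (‖w‖ ^ 2))) := by
  have hpx := truncPow_nonneg hR q (sq_nonneg ‖v‖)
  have hpy := truncPow_nonneg hR q (sq_nonneg ‖w‖)
  rw [mul_add]
  rcases le_total ‖w‖ ‖v‖ with h1 | h1
  · have := norm_rpow_mul_truncPow_le_of_le hβ hβ1 hR q h1
    have : 0 ≤ (2 : ℝ) ^ (2 * q + 2) * (‖v‖ ^ 2 * (1 + truncPow R q (‖w‖ ^ 2))) := by positivity
    linarith
  · have h2 := norm_rpow_mul_truncPow_le_of_le hβ hβ1 hR q h1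
    rw [norm_sub_rev, add_comm (‖w‖ ^ 2) (‖v‖ ^ 2)] at h2
    have : 0 ≤ (2 : ℝ) ^ (2 * q + 2) * (‖w‖ ^ 2 * (1 + truncPow R q (‖v‖ ^ 2))) := by positivity
    linarith

theorem gronwall_integral {y D : ℝ → ℝ} {K T : ℝ} (hK : 0 ≤ K)
    (hD : IntervalIntegrable D volume 0 T) (hT : 0 ≤ T)
    (hy : ∀ t ∈ Icc 0 T, y t = y 0 + ∫ τ in (0 : ℝ)..t, D τ)
    (hle : ∀ t ∈ Icc 0 T, D t ≤ K * y t) : ∀ t ∈ Icc 0 T, y t ≤ y 0 * Real.exp (K * t) := by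
  have hyc : ContinuousOn y (Icc 0 T) := by
    have h1 := intervalIntegral.continuousOn_primitive_interval (a := 0) (b := T) (f := D)
      (μ := volume) (by rw [uIcc_of_le hT, integrableOn_Icc_iff_integrableOn_Ioc]; exact hD.1)
    rw [uIcc_of_le hT] at h1
    exact (continuousOn_const.add h1).congr hy
  -- D is only integrable, so y need not be differentiable. The argument runs on the C¹ majorant Y
  -- with derivative K z, where z extends y continuously to the line.
  set z : ℝ → ℝ := IccExtend hT ((Icc 0 T).domRestrict y) with hz
  have hzc : Continuous z := (continuousOn_iff_continuous_domRestrict.1 hyc).Icc_extend'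
  have hzy : ∀ t ∈ Icc 0 T, z t = y t := fun t ht => by
    rw [hz, IccExtend_of_mem hT _ ht]; rfl
  set Y : ℝ → ℝ := fun t => y 0 + ∫ τ in (0 : ℝ)..t, K * z τ with hY
  have hYd : ∀ t, HasDerivAt Y (K * z t) t := fun t => by
    have := (Continuous.integral_hasStrictDerivAt (f := fun τ => K * z τ) (by fun_prop) 0 t)
    exact this.hasDerivAt.const_add (y 0)
  have hyY : ∀ t ∈ Icc 0 T, y t ≤ Y t := fun t ht => by
    rw [hy t ht]
    simp only [hY]
    gcongr
    refine intervalIntegral.integral_mono_on ht.1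
      (hD.mono_set (by rw [uIcc_of_le ht.1, uIcc_of_le hT]; exact Icc_subset_Icc_right ht.2))
      (Continuous.intervalIntegrable (by fun_prop) _ _) fun s hs => ?_
    have hs' : s ∈ Icc 0 T := ⟨hs.1, hs.2.trans ht.2⟩
    rw [hzy s hs']
    exact hle s hs'
  have hanti : AntitoneOn (fun t => Real.exp (-K * t) * Y t) (Icc 0 T) := by
    have hd : ∀ t, HasDerivAt (fun t => Real.exp (-K * t) * Y t)
        (Real.exp (-K * t) * (-K) * Y t + Real.exp (-K * t) * (K * z t)) t := fun t => by
      have h1 : HasDerivAt (fun t => Real.exp (-K * t)) (Real.exp (-K * t) * (-K)) t := by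
        simpa using ((hasDerivAt_id t).const_mul (-K)).exp
      exact h1.mul (hYd t)
    refine antitoneOn_of_deriv_nonpos (convex_Icc 0 T)
      (fun t _ => (hd t).continuousAt.continuousWithinAt)
      (fun t _ => (hd t).differentiableAt.differentiableWithinAt) fun t ht => ?_
    rw [interior_Icc] at ht
    have ht' := Ioo_subset_Icc_self ht
    rw [(hd t).deriv, hzy t ht']
    have := hyY t ht'
    have : 0 ≤ Real.exp (-K * t) * K * (Y t - y t) := by
      have : 0 ≤ Y t - y t := by linarith
      positivity
    linarith
  intro t ht
  have h1 := hanti ⟨le_rfl, hT⟩ ht ht.1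
  simp only [mul_zero, Real.exp_zero, one_mul] at h1
  have hY0 : Y 0 = y 0 := by simp [hY]
  rw [hY0] at h1
  calc y t ≤ Y t := hyY t ht
    _ = Real.exp (K * t) * (Real.exp (-K * t) * Y t) := by
        rw [← mul_assoc, ← Real.exp_add]; simp
    _ ≤ Real.exp (K * t) * y 0 := by gcongr
    _ = _ := mul_comm _ _

end

/-! ### Propagation of polynomial moments -/

section

variable {d : ℕ} {h : ℝ → ℝ} {A β : ℝ}

theorem integral_symm_prod {X : Type*} [MeasurableSpace X] {μ : Measure X} [SFinite μ]
    {p q : X → ℝ} (hp : Integrable p μ) (hq : Integrable q μ) :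
    Integrable (fun z : X × X => p z.1 * q z.2 + q z.1 * p z.2) (μ.prod μ) ∧
      ∫ z : X × X, (p z.1 * q z.2 + q z.1 * p z.2) ∂(μ.prod μ) = 2 * ((∫ x, p x ∂μ) * ∫ x, q x ∂μ) := by
  refine ⟨(hp.mul_prod hq).add (hq.mul_prod hp), ?_⟩
  rw [integral_add (hp.mul_prod hq) (hq.mul_prod hp), integral_prod_mul, integral_prod_mul]
  ring

section
variable {f₀ : V d → ℝ} {f : V d → ℝ → ℝ}

theorem IsMildSolution.measurable_section {B : V d → S d → ℝ} (hf : IsMildSolution B f₀ f)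
    (t : ℝ) : Measurable (fun v => f v t) :=
  hf.measurable.comp (measurable_id.prodMk measurable_const)

theorem moment_one {B : V d → S d → ℝ} (hf : IsMildSolution B f₀ f)
    (hc : ConservesMassEnergy f₀ f) {t : ℝ} (ht : 0 ≤ t) :
    Integrable (fun v => |f v t| * (1 + ‖v‖ ^ 2) ^ (0 + 1)) ∧
      ∫ v, |f v t| * (1 + ‖v‖ ^ 2) ^ (0 + 1) = (∫ v, f₀ v) + ∫ v, f₀ v * ‖v‖ ^ 2 := by
  have e : (fun v => |f v t| * (1 + ‖v‖ ^ 2) ^ (0 + 1)) =ᵐ[volume]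
      fun v => f v t + f v t * ‖v‖ ^ 2 := by
    filter_upwards [hf.nonneg t ht] with v hv
    rw [abs_of_nonneg hv]; ring
  have i := (hc.mass t ht).1.add (hc.energy t ht).1
  refine ⟨i.congr e.symm, ?_⟩
  rw [integral_congr_ae e, integral_add (hc.mass t ht).1 (hc.energy t ht).1, (hc.mass t ht).2,
    (hc.energy t ht).2]

theorem mass_nonneg {B : V d → S d → ℝ} (hf : IsMildSolution B f₀ f)
    (hc : ConservesMassEnergy f₀ f) : 0 ≤ ∫ v, f₀ v := by
  rw [← (hc.mass 0 le_rfl).2]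
  exact integral_nonneg_of_ae (hf.nonneg 0 le_rfl)

theorem energy_nonneg {B : V d → S d → ℝ} (hf : IsMildSolution B f₀ f)
    (hc : ConservesMassEnergy f₀ f) : 0 ≤ ∫ v, f₀ v * ‖v‖ ^ 2 := by
  rw [← (hc.energy 0 le_rfl).2]
  refine integral_nonneg_of_ae ?_
  filter_upwards [hf.nonneg 0 le_rfl] with v hv
  exact mul_nonneg hv (sq_nonneg _)

theorem truncPow_le_linear {R : ℝ} (hR : 0 ≤ R) (q : ℕ) {r : ℝ} (hr : 0 ≤ r) :
    truncPow R q r ≤ R ^ q * (1 + r) ^ 1 := by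
  have h1 := truncPow_sub_le hR q le_rfl hr
  have h0 : 0 ≤ min r R := le_min hr hR
  simp only [truncPow_zero, sub_zero] at h1
  calc truncPow R q r ≤ r * min r R ^ q := h1
    _ ≤ (1 + r) * R ^ q := by gcongr; linarith; exact min_le_right _ _
    _ = _ := by ring

theorem integrable_mul_truncPow {B : V d → S d → ℝ} (hf : IsMildSolution B f₀ f)
    (hc : ConservesMassEnergy f₀ f) {t : ℝ} (ht : 0 ≤ t) {R : ℝ} (hR : 0 ≤ R) (q : ℕ) :
    Integrable (fun v => f v t * truncPow R q (‖v‖ ^ 2)) := by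
  refine integrable_mul_of_moment (hf.measurable_section t) (moment_one hf hc ht).1
    ((continuous_truncPow R q).measurable.comp (by fun_prop)) (C := R ^ q) fun v => ?_
  rw [abs_of_nonneg (truncPow_nonneg hR q (sq_nonneg _))]
  exact truncPow_le_linear hR q (sq_nonneg _)

/-- Superadditivity and energy conservation bound the weight after the collision by its value at the
total energy; the linear corrections cancel. -/
theorem collisionGain_truncPow_le (H : IsAngularKernel d h A) (hA : 0 ≤ A) (hβ : 0 < β)
    (hβ1 : β ≤ 1) {R : ℝ} (hR : 0 ≤ R) (q : ℕ) (v w : V d) :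
    collisionGain β h (fun v => truncPow R q (‖v‖ ^ 2) - R ^ q * ‖v‖ ^ 2) v w
      ≤ A * (2 ^ (2 * q + 2) * (‖w‖ ^ 2 * (1 + truncPow R q (‖v‖ ^ 2))
        + ‖v‖ ^ 2 * (1 + truncPow R q (‖w‖ ^ 2)))) := by
  have hφm : Measurable (fun v : V d => truncPow R q (‖v‖ ^ 2) - R ^ q * ‖v‖ ^ 2) := by
    have := (continuous_truncPow R q).measurable
    fun_prop
  have hφC : ∀ v : V d, |truncPow R q (‖v‖ ^ 2) - R ^ q * ‖v‖ ^ 2|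
      ≤ R ^ (q + 1) * (1 + ‖v‖ ^ 2) ^ 0 := fun v => by
    rw [pow_zero, mul_one]
    exact abs_truncPow_sub_linear_le hR q (sq_nonneg _)
  have hC0 : 0 ≤ R ^ (q + 1) := by positivity
  obtain ⟨i1, i2⟩ := integrable_gain H hβ hφm hC0 hφC v w
  rw [collisionGain_eq H hβ hφm hC0 hφC]
  set E := ‖v‖ ^ 2 + ‖w‖ ^ 2 with hE
  have h1 : ∫ σ, ((truncPow R q (‖vPrime v w σ‖ ^ 2) - R ^ q * ‖vPrime v w σ‖ ^ 2)
      + (truncPow R q (‖vPrimeStar v w σ‖ ^ 2) - R ^ q * ‖vPrimeStar v w σ‖ ^ 2))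
        * kernel β h (v - w) σ ∂(surface d)
      ≤ (truncPow R q E - R ^ q * E) * (A * ‖v - w‖ ^ β) := by
    rw [← H.integral_kernel hβ, ← integral_const_mul]
    refine integral_mono ((i1.add i2).congr (.of_forall fun σ => (add_mul _ _ _).symm))
      ((H.integrable_kernel hβ _).const_mul _) fun σ => ?_
    refine mul_le_mul_of_nonneg_right ?_ (H.kernel_nonneg _ _)
    have e1 := norm_sq_vPrime_add v w σ
    have e2 := truncPow_add_le hR q (sq_nonneg ‖vPrime v w σ‖) (sq_nonneg ‖vPrimeStar v w σ‖)
    rw [e1] at e2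
    rw [hE, ← e1, mul_add] at *
    linarith
  calc _ ≤ (truncPow R q E - R ^ q * E) * (A * ‖v - w‖ ^ β) - A * ‖v - w‖ ^ β *
        ((truncPow R q (‖v‖ ^ 2) - R ^ q * ‖v‖ ^ 2) + (truncPow R q (‖w‖ ^ 2) - R ^ q * ‖w‖ ^ 2)) :=
        sub_le_sub_right h1 _
    _ = A * (‖v - w‖ ^ β * (truncPow R q E - truncPow R q (‖v‖ ^ 2) - truncPow R q (‖w‖ ^ 2))) := by
        rw [hE]; ring
    _ ≤ _ := mul_le_mul_of_nonneg_left (norm_rpow_mul_truncPow_le hβ hβ1 hR q v w) hA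

/-- The growth rate is independent of R because the kernel estimate is, and bilinear terms always
pair a truncated moment with the conserved energy. Adding the mass makes the differential inequality
homogeneous. -/
theorem truncated_moment_le (hd : 2 ≤ d) (H : IsAngularKernel d h A) (hβ : 0 < β) (hβ1 : β ≤ 1)
    (hf : IsMildSolution (kernel β h) f₀ f) (hc : ConservesMassEnergy f₀ f) {R : ℝ} (hR : 0 ≤ R)
    (q : ℕ) {t : ℝ} (ht : 0 ≤ t) :
    (∫ v, f₀ v) + ∫ v, f v t * truncPow R q (‖v‖ ^ 2)
      ≤ ((∫ v, f₀ v) + ∫ v, f v 0 * truncPow R q (‖v‖ ^ 2))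
        * Real.exp (A * 2 ^ (2 * q + 2) * (∫ v, f₀ v * ‖v‖ ^ 2) * t) := by
  have hA := H.mass_nonneg hd
  set m₀ := ∫ v, f₀ v with hm₀
  set m₁ := ∫ v, f₀ v * ‖v‖ ^ 2 with hm₁
  have hm₁0 : 0 ≤ m₁ := energy_nonneg hf hc
  set φ : V d → ℝ := fun v => truncPow R q (‖v‖ ^ 2) - R ^ q * ‖v‖ ^ 2 with hφ
  have hφm : Measurable φ := by
    have := (continuous_truncPow R q).measurable
    simp only [hφ]; fun_prop
  have hφC : ∀ v : V d, |φ v| ≤ R ^ (q + 1) * (1 + ‖v‖ ^ 2) ^ 0 := fun v => by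
    rw [pow_zero, mul_one]
    exact abs_truncPow_sub_linear_le hR q (sq_nonneg _)
  have hC0 : 0 ≤ R ^ (q + 1) := by positivity
  set F : ℝ → ℝ := fun t => ∫ v, f v t * truncPow R q (‖v‖ ^ 2) with hF
  have hFφ : ∀ τ, 0 ≤ τ → ∫ v, f v τ * φ v = F τ - R ^ q * m₁ := fun τ hτ => by
    rw [hm₁, ← (hc.energy τ hτ).2, ← integral_const_mul, hF, ← integral_sub
      (integrable_mul_truncPow hf hc hτ hR q) ((hc.energy τ hτ).1.const_mul _)]
    congr 1 with v
    simp only [hφ]; ring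
  set D : ℝ → ℝ := fun τ => ∫ v, φ v * collision (kernel β h) (fun w => f w τ) v with hD
  have hDle : ∀ τ, 0 ≤ τ → D τ ≤ A * 2 ^ (2 * q + 2) * m₁ * (m₀ + F τ) := fun τ hτ => by
    have ip : Integrable (fun v => f v τ * (1 + truncPow R q (‖v‖ ^ 2))) := by
      refine ((hc.mass τ hτ).1.add (integrable_mul_truncPow hf hc hτ hR q)).congr
        (.of_forall fun v => ?_)
      simp [mul_add]
    have ep : ∫ v, f v τ * (1 + truncPow R q (‖v‖ ^ 2)) = m₀ + F τ := by
      simp only [mul_add, mul_one]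
      rw [integral_add (hc.mass τ hτ).1 (integrable_mul_truncPow hf hc hτ hR q), (hc.mass τ hτ).2]
    obtain ⟨j1, j2⟩ := integral_symm_prod ip (hc.energy τ hτ).1
    have e : ∀ z : V d × V d, f z.1 τ * f z.2 τ * (A * (2 ^ (2 * q + 2) *
        (‖z.2‖ ^ 2 * (1 + truncPow R q (‖z.1‖ ^ 2)) + ‖z.1‖ ^ 2 * (1 + truncPow R q (‖z.2‖ ^ 2)))))
        = A * 2 ^ (2 * q + 2) * ((f z.1 τ * (1 + truncPow R q (‖z.1‖ ^ 2))) * (f z.2 τ * ‖z.2‖ ^ 2)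
          + (f z.1 τ * ‖z.1‖ ^ 2) * (f z.2 τ * (1 + truncPow R q (‖z.2‖ ^ 2)))) := fun z => by ring
    have := integral_mul_collision_le hd H hβ hβ1 (hf.measurable_section τ) (hf.nonneg τ hτ)
      (moment_one hf hc hτ).1 hφm hC0 hφC (collisionGain_truncPow_le H hA hβ hβ1 hR q)
      (by simp only [e]; exact j1.const_mul _)
    simp only [e] at this
    rw [integral_const_mul, j2, ep, (hc.energy τ hτ).2] at this
    refine this.trans (le_of_eq ?_)
    ring
  have hint : ∀ t, 0 ≤ t → IntervalIntegrable D volume 0 t ∧ F t - F 0 = ∫ τ in (0 : ℝ)..t, D τ :=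
    fun t ht => by
    obtain ⟨h1, h2⟩ := hf.integral_sub_eq hd H hβ hβ1 le_rfl ht (k := 0) (N := m₀ + m₁)
      (fun τ hτ => ⟨(moment_one hf hc hτ.1).1, (moment_one hf hc hτ.1).2.le⟩) hφm hC0 hφC
    refine ⟨h1, ?_⟩
    rw [← h2, hFφ t ht, hFφ 0 le_rfl]
    ring
  have hK : 0 ≤ A * 2 ^ (2 * q + 2) * m₁ := by positivity
  exact gronwall_integral (y := fun t => m₀ + F t) hK (hint t ht).1 ht
    (fun s hs => by linarith [(hint s hs.1).2]) (fun s hs => hDle s hs.1) t ⟨ht, le_rfl⟩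

/-- Propagation of all polynomial moments, locally uniformly in time. -/
theorem exists_moment_bound (hd : 2 ≤ d) (H : IsAngularKernel d h A) (hβ : 0 < β) (hβ1 : β ≤ 1)
    (hf : IsMildSolution (kernel β h) f₀ f) (hc : ConservesMassEnergy f₀ f)
    (h0 : ∀ q : ℕ, Integrable (fun v => f v 0 * (‖v‖ ^ 2) ^ q)) (q : ℕ) (T : ℝ) :
    ∃ N, ∀ t ∈ Icc 0 T, Integrable (fun v => |f v t| * (1 + ‖v‖ ^ 2) ^ (q + 1)) ∧
      ∫ v, |f v t| * (1 + ‖v‖ ^ 2) ^ (q + 1) ≤ N := by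
  have hA := H.mass_nonneg hd
  set m₀ := ∫ v, f₀ v with hm₀
  set m₁ := ∫ v, f₀ v * ‖v‖ ^ 2 with hm₁
  have hm₁0 : 0 ≤ m₁ := energy_nonneg hf hc
  have hm₀0 : 0 ≤ m₀ := mass_nonneg hf hc
  set P := ∫ v, f v 0 * (‖v‖ ^ 2) ^ (q + 1) with hP
  set K := (m₀ + P) * Real.exp (A * 2 ^ (2 * q + 2) * m₁ * T) with hK
  have hP0 : 0 ≤ P := by
    refine integral_nonneg_of_ae ?_
    filter_upwards [hf.nonneg 0 le_rfl] with v hv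
    exact mul_nonneg hv (by positivity)
  refine ⟨2 ^ q * (m₀ + (q + 1) * K), fun t ht => ?_⟩
  have hle : ∀ n : ℕ, ∫ v, f v t * truncPow n q (‖v‖ ^ 2) ≤ K := fun n => by
    have h1 := truncated_moment_le hd H hβ hβ1 hf hc (Nat.cast_nonneg n) q ht.1
    have h2 : ∫ v, f v 0 * truncPow n q (‖v‖ ^ 2) ≤ P := by
      refine integral_mono_ae (integrable_mul_truncPow hf hc le_rfl (Nat.cast_nonneg n) q)
        (h0 (q + 1)) ?_
      filter_upwards [hf.nonneg 0 le_rfl] with v hv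
      exact mul_le_mul_of_nonneg_left (truncPow_le_pow (Nat.cast_nonneg n) q (sq_nonneg _)) hv
    calc ∫ v, f v t * truncPow n q (‖v‖ ^ 2) ≤ _ := le_trans (by linarith) h1
      _ ≤ K := by
        simp only [hK]
        gcongr
        exact ht.2
  obtain ⟨g1, g2⟩ := fatou_bound (μ := (volume : Measure (V d)))
    (F := fun n v => f v t * truncPow n q (‖v‖ ^ 2))
    (G := fun v => f v t * ((‖v‖ ^ 2) ^ (q + 1) / (q + 1))) (K := K)
    (fun n => integrable_mul_truncPow hf hc ht.1 (Nat.cast_nonneg n) q)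
    (fun n => by
      filter_upwards [hf.nonneg t ht.1] with v hv
      exact mul_nonneg hv (truncPow_nonneg (Nat.cast_nonneg n) q (sq_nonneg _)))
    (.of_forall hle)
    (.of_forall fun v => by
      obtain ⟨N, hN⟩ := exists_nat_ge (‖v‖ ^ 2)
      refine tendsto_const_nhds.congr' ?_
      filter_upwards [eventually_ge_atTop N] with n hn
      rw [truncPow_eq q (sq_nonneg _) (hN.trans (by exact_mod_cast hn))])
  have hq : (0 : ℝ) < q + 1 := by positivity
  have hdom : Integrable (fun v => 2 ^ q * (f v t
      + (q + 1) * (f v t * ((‖v‖ ^ 2) ^ (q + 1) / (q + 1))))) :=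
    ((hc.mass t ht.1).1.add (g1.const_mul _)).const_mul _
  have hpt : ∀ᵐ v, |f v t| * (1 + ‖v‖ ^ 2) ^ (q + 1) ≤ 2 ^ q * (f v t
      + (q + 1) * (f v t * ((‖v‖ ^ 2) ^ (q + 1) / (q + 1)))) := by
    filter_upwards [hf.nonneg t ht.1] with v hv
    have := add_pow_le (zero_le_one (α := ℝ)) (sq_nonneg ‖v‖) (q + 1)
    rw [one_pow, Nat.add_sub_cancel] at this
    rw [abs_of_nonneg hv]
    calc f v t * (1 + ‖v‖ ^ 2) ^ (q + 1) ≤ f v t * (2 ^ q * (1 + (‖v‖ ^ 2) ^ (q + 1))) := by gcongr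
      _ = _ := by field_simp
  have hm := hf.measurable_section t
  refine ⟨hdom.mono' (by fun_prop) ?_, ?_⟩
  · filter_upwards [hpt] with v hv
    rwa [Real.norm_of_nonneg (by positivity)]
  · refine (integral_mono_of_nonneg (.of_forall fun v => by positivity) hdom hpt).trans ?_
    rw [integral_const_mul, integral_add (hc.mass t ht.1).1 (g1.const_mul _), integral_const_mul,
      (hc.mass t ht.1).2]
    gcongr

end

end

/-! ### Truncated exponentials and the Povzner inequality -/

section

variable {d : ℕ} {h : ℝ → ℝ} {A β : ℝ}

/-- The Taylor polynomial of degree `n` of `exp z - 1`. -/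
def expTaylor (n : ℕ) (z : ℝ) : ℝ := ∑ k ∈ Finset.Ico 1 (n + 1), z ^ k / k.factorial

theorem continuous_expTaylor (n : ℕ) : Continuous (expTaylor n) := by
  unfold expTaylor; fun_prop

theorem expTaylor_nonneg (n : ℕ) {z : ℝ} (hz : 0 ≤ z) : 0 ≤ expTaylor n z :=
  Finset.sum_nonneg fun k _ => by positivity

theorem one_add_expTaylor (n : ℕ) (z : ℝ) :
    1 + expTaylor n z = ∑ k ∈ Finset.range (n + 1), z ^ k / k.factorial := by
  rw [Finset.range_eq_Ico, Finset.sum_eq_sum_Ico_succ_bot (Nat.succ_pos n)]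
  simp [expTaylor]

theorem one_add_expTaylor_le_exp (n : ℕ) {z : ℝ} (hz : 0 ≤ z) :
    1 + expTaylor n z ≤ Real.exp z := by
  rw [one_add_expTaylor]
  exact Real.sum_le_exp_of_nonneg hz _

theorem add_pow_div_factorial (x y : ℝ) (k : ℕ) :
    (x + y) ^ k / k.factorial = ∑ i ∈ Finset.range (k + 1),
      x ^ i / i.factorial * (y ^ (k - i) / (k - i).factorial) := by
  rw [add_pow, Finset.sum_div]
  refine Finset.sum_congr rfl fun i hi => ?_
  have hik : i ≤ k := Nat.lt_succ_iff.1 (Finset.mem_range.1 hi)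
  have := Nat.choose_mul_factorial_mul_factorial hik
  have h1 : ((k.choose i : ℝ)) * i.factorial * (k - i).factorial = k.factorial := by
    exact_mod_cast this
  rw [← h1]
  have h2 : (i.factorial : ℝ) ≠ 0 := by positivity
  have h3 : ((k - i).factorial : ℝ) ≠ 0 := by positivity
  have h4 : (k.choose i : ℝ) ≠ 0 := by
    have := Nat.choose_pos hik
    positivity
  field_simp

/-- By the binomial theorem the left side collects the terms with i + j ≤ n of the product on the
right; the remaining ones are nonnegative. -/
theorem one_add_expTaylor_add_le (n : ℕ) {x y : ℝ} (hx : 0 ≤ x) (hy : 0 ≤ y) :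
    1 + expTaylor n (x + y) ≤ (1 + expTaylor n x) * (1 + expTaylor n y) := by
  simp only [one_add_expTaylor, add_pow_div_factorial]
  rw [Finset.sum_range_diag_flip (n + 1)
    (fun i j => x ^ i / i.factorial * (y ^ j / j.factorial)), Finset.sum_mul_sum]
  refine Finset.sum_le_sum fun i _ => ?_
  exact Finset.sum_le_sum_of_subset_of_nonneg
    (Finset.range_subset_range.2 (Nat.sub_le _ _)) fun j _ _ => by positivity

theorem tendsto_one_add_expTaylor (z : ℝ) :
    Tendsto (fun n => 1 + expTaylor n z) atTop (𝓝 (Real.exp z)) := by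
  have h1 := (NormedSpace.expSeries_div_hasSum_exp z).tendsto_sum_nat
  rw [← Real.exp_eq_exp_ℝ] at h1
  refine (h1.comp (tendsto_add_atTop_nat 1)).congr fun n => ?_
  rw [one_add_expTaylor]; rfl

theorem expTaylor_mul_le (n : ℕ) {a x : ℝ} (ha : 0 ≤ a) (hx : 0 ≤ x) :
    |expTaylor n (a * x)| ≤ expTaylor n a * (1 + x) ^ n := by
  rw [abs_of_nonneg (expTaylor_nonneg n (by positivity)), expTaylor, expTaylor, Finset.sum_mul]
  refine Finset.sum_le_sum fun k hk => ?_
  have hk' : k ≤ n := Nat.lt_succ_iff.1 (Finset.mem_Ico.1 hk).2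
  rw [mul_pow, mul_div_right_comm]
  gcongr
  calc x ^ k ≤ (1 + x) ^ k := by gcongr; linarith
    _ ≤ (1 + x) ^ n := by gcongr; linarith

/-- The terms of low degree of the exponential series are dominated by a linear term and a small
multiple of a term of higher degree. -/
theorem exists_low_degree_bound {ε s : ℝ} (hε : 0 < ε) (hs : 0 ≤ s) (m : ℕ) :
    ∃ K : ℝ, 0 ≤ K ∧ ∀ z : ℝ, 0 ≤ z →
      (∑ k ∈ Finset.Ico 1 m, z ^ k / k.factorial) * z ^ s
        ≤ K * z + ε * (z ^ m / m.factorial) * z ^ s := by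
  -- Below Z each term is at most a constant times z. Above Z ≥ 1 the at most m terms are each
  -- bounded by z^(m−1), and m · m! ≤ ε z makes their sum at most ε z^m/m!.
  set Z : ℝ := max 1 (m * m.factorial / ε) with hZ
  have hZ1 : 1 ≤ Z := le_max_left _ _
  have hZ0 : 0 ≤ Z := by linarith
  refine ⟨m * Z ^ m * Z ^ s, by positivity, fun z hz => ?_⟩
  rcases le_total z Z with h1 | h1
  · have h2 : ∑ k ∈ Finset.Ico 1 m, z ^ k / k.factorial ≤ m * (Z ^ m * z) := by
      calc _ ≤ ∑ k ∈ Finset.Ico 1 m, Z ^ m * z := by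
            refine Finset.sum_le_sum fun k hk => ?_
            obtain ⟨hk1, hk2⟩ := Finset.mem_Ico.1 hk
            have hf : (1 : ℝ) ≤ k.factorial := by exact_mod_cast Nat.factorial_pos k
            calc z ^ k / k.factorial ≤ z ^ k := div_le_self (by positivity) hf
              _ = z ^ (k - 1) * z := by rw [← pow_succ, Nat.sub_add_cancel hk1]
              _ ≤ Z ^ (k - 1) * z := by gcongr
              _ ≤ Z ^ m * z := by gcongr; omega
        _ ≤ _ := by
            rw [Finset.sum_const, nsmul_eq_mul, Nat.card_Ico]
            gcongr
            exact_mod_cast Nat.sub_le m 1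
    calc _ ≤ m * (Z ^ m * z) * Z ^ s := by gcongr
      _ = m * Z ^ m * Z ^ s * z := by ring
      _ ≤ _ := le_add_of_nonneg_right (by positivity)
  · have hz1 : 1 ≤ z := hZ1.trans h1
    have h2 : ∑ k ∈ Finset.Ico 1 m, z ^ k / k.factorial ≤ ε * (z ^ m / m.factorial) := by
      rcases Nat.eq_zero_or_pos m with rfl | hm
      · simp; positivity
      have h3 : m * m.factorial / ε ≤ z := (le_max_right _ _).trans h1
      rw [div_le_iff₀ hε] at h3
      calc _ ≤ ∑ k ∈ Finset.Ico 1 m, z ^ (m - 1) := by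
            refine Finset.sum_le_sum fun k hk => ?_
            obtain ⟨hk1, hk2⟩ := Finset.mem_Ico.1 hk
            have hf : (1 : ℝ) ≤ k.factorial := by exact_mod_cast Nat.factorial_pos k
            calc z ^ k / k.factorial ≤ z ^ k := div_le_self (by positivity) hf
              _ ≤ z ^ (m - 1) := by gcongr; omega
        _ ≤ m * z ^ (m - 1) := by
            rw [Finset.sum_const, nsmul_eq_mul, Nat.card_Ico]
            gcongr
            exact_mod_cast Nat.sub_le m 1
        _ ≤ ε * (z ^ m / m.factorial) := by
            rw [← mul_div_assoc, le_div_iff₀ (by positivity)]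
            calc m * z ^ (m - 1) * m.factorial = (m * m.factorial) * z ^ (m - 1) := by ring
              _ ≤ (z * ε) * z ^ (m - 1) := by gcongr
              _ = ε * (z ^ (m - 1) * z) := by ring
              _ = ε * z ^ m := by rw [← pow_succ, Nat.sub_add_cancel hm]
    calc _ ≤ ε * (z ^ m / m.factorial) * z ^ s := by gcongr
      _ ≤ _ := le_add_of_nonneg_left (by positivity)

theorem half_add_pow_add_le {s : ℝ} (hs : |s| ≤ 1) {k : ℕ} (hk : 1 ≤ k) :
    ((1 + s) / 2) ^ k + ((1 - s) / 2) ^ k ≤ 1 := by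
  obtain ⟨h1, h2⟩ := abs_le.1 hs
  have e1 : ((1 + s) / 2) ^ k ≤ (1 + s) / 2 :=
    pow_le_of_le_one (by linarith) (by linarith) (by omega)
  have e2 : ((1 - s) / 2) ^ k ≤ (1 - s) / 2 :=
    pow_le_of_le_one (by linarith) (by linarith) (by omega)
  linarith

theorem half_add_pow_add_le_two_mul {s : ℝ} (hs : |s| ≤ 1) {k m : ℕ} (hmk : m ≤ k) :
    ((1 + s) / 2) ^ k + ((1 - s) / 2) ^ k ≤ 2 * ((1 + |s|) / 2) ^ m := by
  obtain ⟨h1, h2⟩ := abs_le.1 hs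
  have h3 := le_abs_self s
  have h4 := neg_abs_le s
  have e0 : ((1 + |s|) / 2) ^ k ≤ ((1 + |s|) / 2) ^ m :=
    pow_le_pow_of_le_one (by positivity) (by linarith) hmk
  have e1 : ((1 + s) / 2) ^ k ≤ ((1 + |s|) / 2) ^ k :=
    pow_le_pow_left₀ (by linarith) (by linarith) _
  have e2 : ((1 - s) / 2) ^ k ≤ ((1 + |s|) / 2) ^ k :=
    pow_le_pow_left₀ (by linarith) (by linarith) _
  linarith

/-- Below degree m only convexity is used, the two powers summing to at most 1. From degree m on,
both are at most ((1 + |s|)/2)^m, a single factor that can be averaged over angles. -/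
theorem expTaylor_postcollisional_le {z s : ℝ} (hz : 0 ≤ z) (hs : |s| ≤ 1) {m n : ℕ}
    (hm : 1 ≤ m) (hmn : m ≤ n) :
    expTaylor n (z * ((1 + s) / 2)) + expTaylor n (z * ((1 - s) / 2))
      ≤ (∑ k ∈ Finset.Ico 1 m, z ^ k / k.factorial)
        + 2 * (∑ k ∈ Finset.Ico m (n + 1), z ^ k / k.factorial) * ((1 + |s|) / 2) ^ m := by
  have e : ∀ k : ℕ, (z * ((1 + s) / 2)) ^ k / k.factorial + (z * ((1 - s) / 2)) ^ k / k.factorial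
      = z ^ k / k.factorial * (((1 + s) / 2) ^ k + ((1 - s) / 2) ^ k) := fun k => by
    rw [mul_pow, mul_pow]; ring
  rw [expTaylor, expTaylor, ← Finset.sum_add_distrib]
  simp only [e]
  rw [← Finset.sum_Ico_consecutive _ hm (by omega : m ≤ n + 1), mul_assoc, mul_comm 2,
    mul_assoc, Finset.sum_mul]
  refine add_le_add (Finset.sum_le_sum fun k hk => ?_) (Finset.sum_le_sum fun k hk => ?_)
  · exact mul_le_of_le_one_right (by positivity)
      (half_add_pow_add_le hs (Finset.mem_Ico.1 hk).1)
  · refine mul_le_mul_of_nonneg_left ?_ (by positivity)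
    rw [mul_comm]
    exact half_add_pow_add_le_two_mul hs (Finset.mem_Ico.1 hk).1

theorem norm_sub_rpow_le_energy (hβ : 0 < β) (hβ1 : β ≤ 1) (v w : V d) :
    ‖v - w‖ ^ β ≤ 2 * (‖v‖ ^ 2 + ‖w‖ ^ 2) ^ (β / 2) := by
  have h1 : ‖v - w‖ ^ 2 ≤ 2 * (‖v‖ ^ 2 + ‖w‖ ^ 2) := by
    have := norm_sub_le v w
    nlinarith [sq_nonneg (‖v‖ - ‖w‖), norm_nonneg (v - w), norm_nonneg v, norm_nonneg w]
  have h2 : ‖v - w‖ ^ β = (‖v - w‖ ^ 2) ^ (β / 2) := by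
    rw [← Real.rpow_two, ← Real.rpow_mul (norm_nonneg _)]; congr 1; ring
  rw [h2]
  refine (Real.rpow_le_rpow (sq_nonneg _) h1 (by positivity)).trans ?_
  rw [Real.mul_rpow (by norm_num) (by positivity)]
  gcongr
  calc (2 : ℝ) ^ (β / 2) ≤ 2 ^ (1 : ℝ) :=
        Real.rpow_le_rpow_of_exponent_le (by norm_num) (by linarith)
    _ = 2 := Real.rpow_one 2

theorem energy_rpow_le (hβ : 0 < β) (hβ1 : β ≤ 1) (v w : V d) :
    (‖v‖ ^ 2 + ‖w‖ ^ 2) ^ (β / 2) ≤ ‖v‖ ^ β + ‖w‖ ^ β := by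
  have h2 : ∀ u : V d, ‖u‖ ^ β = (‖u‖ ^ 2) ^ (β / 2) := fun u => by
    rw [← Real.rpow_two, ← Real.rpow_mul (norm_nonneg _)]; congr 1; ring
  rw [h2 v, h2 w]
  exact Real.rpow_add_le_add_rpow (sq_nonneg _) (sq_nonneg _) (by positivity) (by linarith)

/-- Angular averaging of the truncated exponential weight after the collision. -/
theorem exists_povzner_bound (H : IsAngularKernel d h A) (hd : 2 ≤ d) (hA : 0 < A) (hβ : 0 < β)
    (hβ1 : β ≤ 1) :
    ∃ (L : ℝ) (m : ℕ), 0 ≤ L ∧ ∀ a : ℝ, 0 < a → a ≤ 1 → ∀ n, m ≤ n → ∀ v w : V d,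
      ∫ σ, (expTaylor n (a * ‖vPrime v w σ‖ ^ 2) + expTaylor n (a * ‖vPrimeStar v w σ‖ ^ 2))
          * kernel β h (v - w) σ ∂(surface d)
        ≤ L * (‖v‖ ^ 2 + ‖w‖ ^ 2) + A / 6 * ((‖v‖ ^ β + ‖w‖ ^ β)
          * ((1 + expTaylor n (a * ‖v‖ ^ 2)) * (1 + expTaylor n (a * ‖w‖ ^ 2)))) := by
  -- The final A/6 is the sum of two shares A/12: 2 · A/24 from the averaged high degrees, and 2A ·
  -- 1/24 from the high-degree part of the bound on the low degrees.
  obtain ⟨m₀, hm₀⟩ := H.exists_average_le hd (show 0 < A / 24 by positivity)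
  set m := max m₀ 1 with hm
  have hm1 : 1 ≤ m := le_max_right _ _
  obtain ⟨K, hK0, hK⟩ := exists_low_degree_bound (show (0 : ℝ) < 1 / 24 by norm_num)
    (show 0 ≤ β / 2 by positivity) m
  refine ⟨2 * A * K, m, by positivity, fun a ha ha1 n hn v w => ?_⟩
  set E := ‖v‖ ^ 2 + ‖w‖ ^ 2 with hE
  have hE0 : 0 ≤ E := by positivity
  set ρ := ‖v‖ ^ β + ‖w‖ ^ β with hρ
  have hρ0 : 0 ≤ ρ := by positivity
  set low := ∑ k ∈ Finset.Ico 1 m, (a * E) ^ k / k.factorial with hlow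
  set high := ∑ k ∈ Finset.Ico m (n + 1), (a * E) ^ k / k.factorial with hhigh
  have hlow0 : 0 ≤ low := Finset.sum_nonneg fun k _ => by positivity
  have hhigh0 : 0 ≤ high := Finset.sum_nonneg fun k _ => by positivity
  obtain ⟨e, he1, he⟩ := exists_postcollisional_cosine v w
  have hs : ∀ σ : S d, |inner ℝ e (σ : V d)| ≤ 1 := fun σ => by
    have := abs_real_inner_le_norm e (σ : V d)
    rw [norm_eq_of_mem_sphere, mul_one] at this
    exact this.trans he1
  set Θ : S d → ℝ := fun σ => ((1 + |inner ℝ e (σ : V d)|) / 2) ^ m with hΘ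
  have hΘ0 : ∀ σ, 0 ≤ Θ σ := fun σ => by positivity
  have hΘ1 : ∀ σ, Θ σ ≤ 1 := fun σ => pow_le_one₀ (by positivity) (by linarith [hs σ])
  have hΘm : Measurable Θ := by simp only [hΘ]; fun_prop
  have iK := H.integrable_kernel hβ (v - w)
  have iΘ : Integrable (fun σ => Θ σ * kernel β h (v - w) σ) (surface d) :=
    iK.bdd_mul (c := 1) hΘm.aestronglyMeasurable
      (.of_forall fun σ => by rw [Real.norm_of_nonneg (hΘ0 σ)]; exact hΘ1 σ)
  have hΘint : ∫ σ, Θ σ * kernel β h (v - w) σ ∂(surface d) ≤ A / 24 * ‖v - w‖ ^ β := by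
    rcases eq_or_ne (v - w) 0 with h0 | h0
    · simp [h0, kernel, Real.zero_rpow hβ.ne']
    · have e1 : ∀ σ : S d, Θ σ * kernel β h (v - w) σ = ‖v - w‖ ^ β *
          (Θ σ * h (inner ℝ ((‖v - w‖⁻¹ : ℝ) • (v - w)) (σ : V d))) := fun σ => by
        rw [IsAngularKernel.kernel_eq]; ring
      simp only [e1]
      rw [integral_const_mul, mul_comm]
      gcongr
      exact hm₀ m (le_max_left _ _) _ e (by simp [norm_smul, h0]) he1
  have hpt : ∀ σ, expTaylor n (a * ‖vPrime v w σ‖ ^ 2) + expTaylor n (a * ‖vPrimeStar v w σ‖ ^ 2)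
      ≤ low + 2 * high * Θ σ := fun σ => by
    rw [(he σ).1, (he σ).2, ← mul_assoc, ← mul_assoc]
    exact expTaylor_postcollisional_le (by positivity) (hs σ) hm1 hn
  have step1 : ∫ σ, (expTaylor n (a * ‖vPrime v w σ‖ ^ 2)
        + expTaylor n (a * ‖vPrimeStar v w σ‖ ^ 2)) * kernel β h (v - w) σ ∂(surface d)
      ≤ low * (A * ‖v - w‖ ^ β) + 2 * high * (A / 24 * ‖v - w‖ ^ β) := by
    calc _ ≤ ∫ σ, (low * kernel β h (v - w) σ + 2 * high * (Θ σ * kernel β h (v - w) σ))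
          ∂(surface d) := by
          refine integral_mono_of_nonneg (.of_forall fun σ => ?_)
            ((iK.const_mul _).add (iΘ.const_mul _)) (.of_forall fun σ => ?_)
          · exact mul_nonneg (add_nonneg (expTaylor_nonneg n (by positivity))
              (expTaylor_nonneg n (by positivity))) (H.kernel_nonneg _ _)
          · refine (mul_le_mul_of_nonneg_right (hpt σ) (H.kernel_nonneg _ _)).trans (le_of_eq ?_)
            ring
      _ ≤ _ := by
          rw [integral_add (iK.const_mul _) (iΘ.const_mul _), integral_const_mul,
            integral_const_mul, H.integral_kernel hβ]
          gcongr
  refine step1.trans ?_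
  have hu := norm_sub_rpow_le_energy hβ hβ1 v w
  have hu' := norm_sub_rpow_le hβ hβ1 v w
  have hEρ : E ^ (β / 2) ≤ ρ := energy_rpow_le hβ hβ1 v w
  have hmhigh : (a * E) ^ m / m.factorial ≤ high :=
    Finset.single_le_sum (f := fun k : ℕ => (a * E) ^ k / (k.factorial : ℝ))
      (fun k _ => by positivity) (Finset.mem_Ico.2 ⟨le_rfl, by omega⟩)
  have hhighle : high ≤ (1 + expTaylor n (a * ‖v‖ ^ 2)) * (1 + expTaylor n (a * ‖w‖ ^ 2)) := by
    refine le_trans ?_ (one_add_expTaylor_add_le n (by positivity) (by positivity))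
    rw [← mul_add, ← hE, expTaylor]
    refine le_trans ?_ (le_add_of_nonneg_left zero_le_one)
    exact Finset.sum_le_sum_of_subset_of_nonneg (Finset.Ico_subset_Ico_left hm1)
      fun k _ _ => by positivity
  have hap : 0 < a ^ (β / 2) := by positivity
  have hlowE : low * E ^ (β / 2) ≤ K * E + 1 / 24 * high * ρ := by
    have h1 := hK (a * E) (by positivity)
    rw [Real.mul_rpow ha.le hE0] at h1
    -- The low-degree bound is applied at z = aE. Since a ≤ a^(β/2) for a ≤ 1, the factor a^(β/2)
    -- cancels, which keeps L independent of a.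
    have h2 : a ^ (β / 2) * (low * E ^ (β / 2))
        ≤ a ^ (β / 2) * (K * E + 1 / 24 * high * ρ) := by
      have h3 : a ≤ a ^ (β / 2) := by
        conv_lhs => rw [← Real.rpow_one a]
        exact Real.rpow_le_rpow_of_exponent_ge ha ha1 (by linarith)
      calc a ^ (β / 2) * (low * E ^ (β / 2)) = low * (a ^ (β / 2) * E ^ (β / 2)) := by ring
        _ ≤ _ := h1
        _ ≤ K * (a ^ (β / 2) * E) + 1 / 24 * high * (a ^ (β / 2) * ρ) := by gcongr
        _ = _ := by ring
    exact le_of_mul_le_mul_left h2 hap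
  calc low * (A * ‖v - w‖ ^ β) + 2 * high * (A / 24 * ‖v - w‖ ^ β)
      ≤ low * (A * (2 * E ^ (β / 2))) + 2 * high * (A / 24 * ρ) := by gcongr
    _ = 2 * A * (low * E ^ (β / 2)) + A / 12 * (high * ρ) := by ring
    _ ≤ 2 * A * (K * E + 1 / 24 * high * ρ) + A / 12 * (high * ρ) := by gcongr
    _ = 2 * A * K * E + A / 6 * (ρ * high) := by ring
    _ ≤ _ := by gcongr

end

/-! ### Uniform propagation of Gaussian moments -/

section

variable {d : ℕ} {h : ℝ → ℝ} {A β : ℝ} {f₀ : V d → ℝ} {f : V d → ℝ → ℝ}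

/-- A continuous function that cannot increase while its value is in `[m, 2m]` stays below `m`. -/
theorem barrier {F D : ℝ → ℝ} {m T : ℝ} (hm : 0 < m)
    (hD : IntervalIntegrable D volume 0 T)
    (hF : ∀ s t, 0 ≤ s → s ≤ t → t ≤ T → F t - F s = ∫ τ in s..t, D τ)
    (hD0 : ∀ t ∈ Icc 0 T, m ≤ F t → F t ≤ 2 * m → D t ≤ 0) (h0 : F 0 ≤ m) (hT : 0 ≤ T) :
    F T ≤ m := by
  have hFc : ContinuousOn F (Icc 0 T) := by
    have h1 := intervalIntegral.continuousOn_primitive_interval (a := 0) (b := T) (f := D)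
      (μ := volume) (by rw [uIcc_of_le hT, integrableOn_Icc_iff_integrableOn_Ioc]; exact hD.1)
    rw [uIcc_of_le hT] at h1
    refine (continuousOn_const (c := F 0) |>.add h1).congr fun t ht => ?_
    simp only [Pi.add_apply]
    linarith [hF 0 t le_rfl ht.1 ht.2]
  by_contra! hlt
  set S := Icc 0 T ∩ F ⁻¹' Iic m with hS
  have hSc : IsCompact S := isCompact_Icc.of_isClosed_subset
    (hFc.preimage_isClosed_of_isClosed isClosed_Icc isClosed_Iic) inter_subset_left
  -- At the last time s with F ≤ m, continuity keeps F in (m, 2m) just afterwards. There D ≤ 0, so F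
  -- stays below m, contradicting the choice of s.
  obtain ⟨s, hsS, hsup⟩ := hSc.exists_isGreatest ⟨0, ⟨le_rfl, hT⟩, h0⟩
  have hsT : s < T := lt_of_le_of_ne hsS.1.2 (by rintro rfl; exact absurd hsS.2 (not_le.2 hlt))
  have hafter : ∀ τ, s < τ → τ ≤ T → m < F τ := fun τ h1 h2 => by
    by_contra! h3
    exact absurd (hsup ⟨⟨hsS.1.1.trans h1.le, h2⟩, h3⟩) (not_le.2 h1)
  have hnear : ∀ᶠ τ in 𝓝[Icc 0 T] s, F τ < 2 * m :=
    (hFc s hsS.1).eventually (gt_mem_nhds (lt_of_le_of_lt hsS.2 (by linarith)))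
  obtain ⟨δ, hδ, hball⟩ := Metric.mem_nhdsWithin_iff.1 hnear
  set t := min T (s + δ / 2) with ht
  have hst : s < t := lt_min hsT (by linarith)
  have htT : t ≤ T := min_le_left _ _
  have htδ : t ≤ s + δ / 2 := min_le_right _ _
  have hneg : ∫ τ in s..t, D τ ≤ 0 := by
    rw [intervalIntegral.integral_of_le hst.le]
    refine setIntegral_nonpos measurableSet_Ioc fun τ hτ => ?_
    have hτm : τ ∈ Icc 0 T := ⟨hsS.1.1.trans hτ.1.le, hτ.2.trans htT⟩
    refine hD0 τ hτm (hafter τ hτ.1 (hτ.2.trans htT)).le (le_of_lt (hball ⟨?_, hτm⟩))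
    rw [Metric.mem_ball, Real.dist_eq, abs_lt]
    constructor <;> linarith [hτ.1, hτ.2]
  have h1 := hF s t hsS.1.1 hst.le htT
  have h2 := hafter t hst htT
  have h3 : F s ≤ m := hsS.2
  linarith

theorem measurable_expTaylor_norm (n : ℕ) (a : ℝ) :
    Measurable (fun v : V d => expTaylor n (a * ‖v‖ ^ 2)) :=
  (continuous_expTaylor n).measurable.comp (by fun_prop)

/-- Bound of the collision gain for the truncated exponential weight. -/
theorem collisionGain_expTaylor_le (H : IsAngularKernel d h A) (hA : 0 < A) (hβ : 0 < β)
    (hβ1 : β ≤ 1) {L a : ℝ} {n : ℕ} (ha : 0 ≤ a)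
    (hL : ∀ v w : V d,
      ∫ σ, (expTaylor n (a * ‖vPrime v w σ‖ ^ 2) + expTaylor n (a * ‖vPrimeStar v w σ‖ ^ 2))
          * kernel β h (v - w) σ ∂(surface d)
        ≤ L * (‖v‖ ^ 2 + ‖w‖ ^ 2) + A / 6 * ((‖v‖ ^ β + ‖w‖ ^ β)
          * ((1 + expTaylor n (a * ‖v‖ ^ 2)) * (1 + expTaylor n (a * ‖w‖ ^ 2))))) (v w : V d) :
    collisionGain β h (fun v => expTaylor n (a * ‖v‖ ^ 2)) v w
      ≤ L * (‖v‖ ^ 2 + ‖w‖ ^ 2) + A / 6 * ((‖v‖ ^ β + ‖w‖ ^ β)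
          * ((1 + expTaylor n (a * ‖v‖ ^ 2)) * (1 + expTaylor n (a * ‖w‖ ^ 2))))
        - A * ((‖v‖ ^ β - ‖w‖ ^ β) * (expTaylor n (a * ‖v‖ ^ 2) - expTaylor n (a * ‖w‖ ^ 2))) := by
  rw [collisionGain_eq H hβ (measurable_expTaylor_norm n a) (expTaylor_nonneg n ha)
    (fun v => expTaylor_mul_le n ha (sq_nonneg _))]
  -- Subadditivity of |·|^β bounds the loss below by the product of differences, which integrates
  -- into products of single moments: a full −A m₀ J and a cross term F m_β.
  have h1 : ‖v‖ ^ β - ‖w‖ ^ β ≤ ‖v - w‖ ^ β := by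
    have := norm_sub_rpow_le hβ hβ1 (v - w) (-w)
    rw [sub_neg_eq_add, sub_add_cancel, norm_neg] at this
    linarith
  have h2 : ‖w‖ ^ β - ‖v‖ ^ β ≤ ‖v - w‖ ^ β := by
    have := norm_sub_rpow_le hβ hβ1 (v - w) v
    rw [sub_sub_cancel_left, norm_neg] at this
    linarith
  have p1 := expTaylor_nonneg n (mul_nonneg ha (sq_nonneg ‖v‖))
  have p2 := expTaylor_nonneg n (mul_nonneg ha (sq_nonneg ‖w‖))
  have h3 : (‖v‖ ^ β - ‖w‖ ^ β) * (expTaylor n (a * ‖v‖ ^ 2) - expTaylor n (a * ‖w‖ ^ 2))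
      ≤ ‖v - w‖ ^ β * (expTaylor n (a * ‖v‖ ^ 2) + expTaylor n (a * ‖w‖ ^ 2)) := by
    nlinarith [mul_le_mul_of_nonneg_right h1 p1, mul_le_mul_of_nonneg_right h2 p2]
  have h4 := mul_le_mul_of_nonneg_left h3 hA.le
  linarith [hL v w]

/-- The differential inequality for the truncated exponential moment. -/
theorem integral_expTaylor_collision_le (hd : 2 ≤ d) (H : IsAngularKernel d h A) (hA : 0 < A)
    (hβ : 0 < β) (hβ1 : β ≤ 1) {g : V d → ℝ} (hg : Measurable g) (hg0 : ∀ᵐ v, 0 ≤ g v)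
    {L a : ℝ} {n : ℕ} (ha : 0 ≤ a)
    (hgi : Integrable (fun v => |g v| * (1 + ‖v‖ ^ 2) ^ (n + 1)))
    (hL : ∀ v w : V d,
      ∫ σ, (expTaylor n (a * ‖vPrime v w σ‖ ^ 2) + expTaylor n (a * ‖vPrimeStar v w σ‖ ^ 2))
          * kernel β h (v - w) σ ∂(surface d)
        ≤ L * (‖v‖ ^ 2 + ‖w‖ ^ 2) + A / 6 * ((‖v‖ ^ β + ‖w‖ ^ β)
          * ((1 + expTaylor n (a * ‖v‖ ^ 2)) * (1 + expTaylor n (a * ‖w‖ ^ 2))))) :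
    ∫ v, expTaylor n (a * ‖v‖ ^ 2) * collision (kernel β h) g v
      ≤ L * ((∫ v, g v * ‖v‖ ^ 2) * ∫ v, g v)
        + A / 6 * (((∫ v, g v * ‖v‖ ^ β) + ∫ v, g v * (‖v‖ ^ β * expTaylor n (a * ‖v‖ ^ 2)))
          * ((∫ v, g v) + ∫ v, g v * expTaylor n (a * ‖v‖ ^ 2)))
        - A * ((∫ v, g v * (‖v‖ ^ β * expTaylor n (a * ‖v‖ ^ 2))) * (∫ v, g v)
          - (∫ v, g v * expTaylor n (a * ‖v‖ ^ 2)) * ∫ v, g v * ‖v‖ ^ β) := by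
  have hψm := measurable_expTaylor_norm (d := d) n a
  set ψ : V d → ℝ := fun v => expTaylor n (a * ‖v‖ ^ 2) with hψ
  have hψ0 : ∀ v, 0 ≤ ψ v := fun v => expTaylor_nonneg n (by positivity)
  set C := expTaylor n a with hC
  have hC0 : 0 ≤ C := expTaylor_nonneg n ha
  have hψC : ∀ v, |ψ v| ≤ C * (1 + ‖v‖ ^ 2) ^ n := fun v => expTaylor_mul_le n ha (sq_nonneg _)
  have hone : ∀ (v : V d), 1 ≤ 1 + ‖v‖ ^ 2 := fun v => by nlinarith [sq_nonneg ‖v‖]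
  have hpow : ∀ (v : V d), 1 + ‖v‖ ^ 2 ≤ (1 + ‖v‖ ^ 2) ^ (n + 1) := fun v => by
    calc 1 + ‖v‖ ^ 2 = (1 + ‖v‖ ^ 2) ^ 1 := (pow_one _).symm
      _ ≤ _ := pow_le_pow_right₀ (hone v) (by omega)
  have iI : Integrable (fun v => g v) := by
    have := integrable_mul_of_moment hg hgi (q := fun _ => 1) measurable_const (C := 1) fun v => by
      rw [abs_one, one_mul]; exact (hone v).trans (hpow v)
    simpa using this
  have iE : Integrable (fun v => g v * ‖v‖ ^ 2) :=
    integrable_mul_of_moment hg hgi (by fun_prop) (C := 1) fun v => by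
      rw [abs_of_nonneg (by positivity), one_mul]; linarith [hpow v]
  have iρ : Integrable (fun v => g v * ‖v‖ ^ β) :=
    integrable_mul_of_moment hg hgi (by fun_prop) (C := 1) fun v => by
      rw [abs_of_nonneg (by positivity), one_mul]
      exact (norm_rpow_le hβ hβ1 v).trans (hpow v)
  have iψ : Integrable (fun v => g v * ψ v) :=
    integrable_mul_of_moment hg (moment_mono hg n.le_succ hgi) hψm hψC
  have iρψ : Integrable (fun v => g v * (‖v‖ ^ β * ψ v)) :=
    integrable_mul_of_moment hg hgi (by fun_prop) (C := C) fun v => by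
      rw [abs_mul, abs_of_nonneg (by positivity : 0 ≤ ‖v‖ ^ β)]
      calc ‖v‖ ^ β * |ψ v| ≤ (1 + ‖v‖ ^ 2) * (C * (1 + ‖v‖ ^ 2) ^ n) :=
            mul_le_mul (norm_rpow_le hβ hβ1 v) (hψC v) (abs_nonneg _) (by positivity)
        _ = _ := by ring
  have i1 : Integrable (fun v => g v + g v * ψ v) := iI.add iψ
  have i2 : Integrable (fun v => g v * ‖v‖ ^ β + g v * (‖v‖ ^ β * ψ v)) := iρ.add iρψ
  obtain ⟨a1, b1⟩ := integral_symm_prod iE iI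
  obtain ⟨a2, b2⟩ := integral_symm_prod i2 i1
  obtain ⟨a3, b3⟩ := integral_symm_prod iρψ iI
  obtain ⟨a4, b4⟩ := integral_symm_prod iψ iρ
  set b : V d → V d → ℝ := fun v w => L * (‖v‖ ^ 2 + ‖w‖ ^ 2) + A / 6 * ((‖v‖ ^ β + ‖w‖ ^ β)
          * ((1 + ψ v) * (1 + ψ w))) - A * ((‖v‖ ^ β - ‖w‖ ^ β) * (ψ v - ψ w)) with hb
  have e : (fun z : V d × V d => g z.1 * g z.2 * b z.1 z.2) = fun z =>
      (L * (g z.1 * ‖z.1‖ ^ 2 * g z.2 + g z.1 * (g z.2 * ‖z.2‖ ^ 2))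
      + A / 6 * ((g z.1 * ‖z.1‖ ^ β + g z.1 * (‖z.1‖ ^ β * ψ z.1)) * (g z.2 + g z.2 * ψ z.2)
        + (g z.1 + g z.1 * ψ z.1) * (g z.2 * ‖z.2‖ ^ β + g z.2 * (‖z.2‖ ^ β * ψ z.2))))
      - A * ((g z.1 * (‖z.1‖ ^ β * ψ z.1) * g z.2 + g z.1 * (g z.2 * (‖z.2‖ ^ β * ψ z.2)))
        - (g z.1 * ψ z.1 * (g z.2 * ‖z.2‖ ^ β) + g z.1 * ‖z.1‖ ^ β * (g z.2 * ψ z.2))) := by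
    ext z; simp only [hb]; ring
  have c1 := (a1.const_mul L).add (a2.const_mul (A / 6))
  have c2 := (a3.sub a4).const_mul A
  have key := integral_mul_collision_le hd H hβ hβ1 hg hg0 hgi hψm hC0 hψC (b := b)
    (collisionGain_expTaylor_le H hA hβ hβ1 ha hL) (by rw [e]; exact c1.sub c2)
  refine key.trans (le_of_eq ?_)
  have ev := integral_sub c1 c2
  rw [integral_add' (a1.const_mul L) (a2.const_mul (A / 6)), integral_const_mul,
    integral_const_mul, integral_const_mul, integral_sub' a3 a4] at ev
  simp only [Pi.add_apply, Pi.sub_apply] at ev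
  rw [e, ev, b1, b2, b3, b4, integral_add iI iψ, integral_add iρ iρψ]
  ring

/-- Propagation of Gaussian moments when the collision frequency does not vanish. -/
theorem exists_exponential_moment_bound (hd : 2 ≤ d) (H : IsAngularKernel d h A) (hA : 0 < A)
    (hβ : 0 < β) (hβ1 : β ≤ 1) (hf : IsMildSolution (kernel β h) f₀ f)
    (hc : ConservesMassEnergy f₀ f) (hm₀ : 0 < ∫ v, f₀ v) {a₀ : ℝ} (ha₀ : 0 < a₀)
    (hexp : Integrable (fun v => f v 0 * Real.exp (a₀ * ‖v‖ ^ 2))) :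
    ∃ a : ℝ, 0 < a ∧ ∀ t, 0 ≤ t →
      Integrable (fun v => f v t * Real.exp (a * ‖v‖ ^ 2)) ∧
      ∫ v, f v t * Real.exp (a * ‖v‖ ^ 2) ≤ 2 * ∫ v, f₀ v := by
  obtain ⟨L, m, hL0, hL⟩ := exists_povzner_bound H hd hA hβ hβ1
  set m₀ := ∫ v, f₀ v with hm₀'
  set m₁ := ∫ v, f₀ v * ‖v‖ ^ 2 with hm₁
  have hm₁0 : 0 ≤ m₁ := energy_nonneg hf hc
  -- all polynomial moments are finite
  have hpoly : ∀ q : ℕ, Integrable (fun v => f v 0 * (‖v‖ ^ 2) ^ q) := fun q => by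
    have hfm := hf.measurable_section 0
    refine (hexp.norm.const_mul (q.factorial / a₀ ^ q)).mono' (by fun_prop)
      (.of_forall fun v => ?_)
    have h1 := Real.pow_div_factorial_le_exp (a₀ * ‖v‖ ^ 2) (by positivity) q
    rw [div_le_iff₀ (by positivity), mul_pow] at h1
    rw [norm_mul, norm_mul, Real.norm_of_nonneg (by positivity : 0 ≤ (‖v‖ ^ 2) ^ q),
      Real.norm_of_nonneg (Real.exp_pos _).le]
    have h2 : (‖v‖ ^ 2) ^ q ≤ q.factorial / a₀ ^ q * Real.exp (a₀ * ‖v‖ ^ 2) := by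
      rw [div_mul_eq_mul_div, le_div_iff₀ (by positivity)]
      linarith
    calc ‖f v 0‖ * (‖v‖ ^ 2) ^ q
        ≤ ‖f v 0‖ * (q.factorial / a₀ ^ q * Real.exp (a₀ * ‖v‖ ^ 2)) := by gcongr
      _ = _ := by ring
  -- choice of the exponent
  set P := ∫ v, f v 0 * Real.exp (a₀ * ‖v‖ ^ 2) with hP
  have hP0 : 0 ≤ P := by
    refine integral_nonneg_of_ae ?_
    filter_upwards [hf.nonneg 0 le_rfl] with v hv
    exact mul_nonneg hv (Real.exp_pos _).le
  -- Half of the loss, (A/2) m₀ J with J ≥ R^β m₀/2, must outweigh m₀(L m₁ + (5/2) A m_β), where m_β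
  -- ≤ m₀ + m₁. The 5/2 is 1/2 from the gain plus 2 from the cross term F m_β ≤ 2 m₀ m_β.
  obtain ⟨R, hR1, hR⟩ : ∃ R : ℝ, 1 ≤ R ∧
      4 * (L * m₁ + 5 / 2 * A * (m₀ + m₁)) / (A * m₀) ≤ R ^ β := by
    have := ((tendsto_rpow_atTop hβ).eventually_ge_atTop
      (4 * (L * m₁ + 5 / 2 * A * (m₀ + m₁)) / (A * m₀))).and (eventually_ge_atTop 1)
    obtain ⟨R, h1, h2⟩ := this.exists
    exact ⟨R, h2, h1⟩
  rw [div_le_iff₀ (by positivity)] at hR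
  have hlog : 0 < Real.log (3 / 2) := Real.log_pos (by norm_num)
  -- The bound 1 is for the Povzner inequality, a₀ for comparison with the initial weight,
  -- log(3/2)/R² for ψ_n ≤ 1/2 on |v| ≤ R, and the last for F(0) ≤ m₀. The 1 in P + 1 avoids a zero
  -- denominator.
  set a := min (min 1 a₀) (min (Real.log (3 / 2) / R ^ 2) (a₀ * m₀ / (P + 1))) with ha
  have ha0 : 0 < a := by
    simp only [ha, lt_min_iff]
    refine ⟨⟨one_pos, ha₀⟩, ?_, ?_⟩ <;> positivity
  have ha1 : a ≤ 1 := (min_le_left _ _).trans (min_le_left _ _)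
  have haa₀ : a ≤ a₀ := (min_le_left _ _).trans (min_le_right _ _)
  have haR : a * R ^ 2 ≤ Real.log (3 / 2) := by
    rw [← le_div_iff₀ (by positivity)]
    exact (min_le_right _ _).trans (min_le_left _ _)
  have haP : a * P ≤ a₀ * m₀ := by
    have : a * (P + 1) ≤ a₀ * m₀ := by
      rw [← le_div_iff₀ (by positivity)]
      exact (min_le_right _ _).trans (min_le_right _ _)
    linarith
  have hψle : ∀ n t, 0 ≤ t → Integrable (fun v => f v t * expTaylor n (a * ‖v‖ ^ 2)) := fun n t ht => by
    obtain ⟨N, hN⟩ := exists_moment_bound hd H hβ hβ1 hf hc hpoly n t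
    exact integrable_mul_of_moment (hf.measurable_section t)
      (moment_mono (hf.measurable_section t) n.le_succ (hN t ⟨ht, le_rfl⟩).1)
      (measurable_expTaylor_norm n a) (fun v => expTaylor_mul_le n ha0.le (sq_nonneg _))
  -- the initial value
  have hinit : ∀ n, ∫ v, f v 0 * expTaylor n (a * ‖v‖ ^ 2) ≤ m₀ := fun n => by
    have hpt : ∀ᵐ v, f v 0 * expTaylor n (a * ‖v‖ ^ 2)
        ≤ a / a₀ * (f v 0 * Real.exp (a₀ * ‖v‖ ^ 2)) := by
      filter_upwards [hf.nonneg 0 le_rfl] with v hv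
      have hr : a / a₀ ≤ 1 := (div_le_one ha₀).2 haa₀
      -- Convexity between 0 and a₀|v|² gives e^{a|v|²} − 1 ≤ (a/a₀)(e^{a₀|v|²} − 1). Because the
      -- weight has no constant term, the initial moment gains the small factor a/a₀.
      have hconv := convexOn_exp.2 (mem_univ (a₀ * ‖v‖ ^ 2)) (mem_univ 0)
        (by positivity : 0 ≤ a / a₀) (by linarith : 0 ≤ 1 - a / a₀) (by ring)
      simp only [smul_eq_mul, mul_zero, add_zero, Real.exp_zero, mul_one] at hconv
      have e1 : a / a₀ * (a₀ * ‖v‖ ^ 2) = a * ‖v‖ ^ 2 := by field_simp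
      rw [e1] at hconv
      have h2 := one_add_expTaylor_le_exp n (by positivity : 0 ≤ a * ‖v‖ ^ 2)
      have h3 : expTaylor n (a * ‖v‖ ^ 2) ≤ a / a₀ * Real.exp (a₀ * ‖v‖ ^ 2) := by
        have : 0 ≤ a / a₀ := by positivity
        linarith
      calc _ ≤ f v 0 * (a / a₀ * Real.exp (a₀ * ‖v‖ ^ 2)) := by gcongr
        _ = _ := by ring
    refine (integral_mono_ae (hψle n 0 le_rfl) (hexp.const_mul _) hpt).trans ?_
    rw [integral_const_mul, ← hP, div_mul_eq_mul_div, div_le_iff₀ ha₀]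
    linarith
  have hbound : ∀ n, m ≤ n → ∀ T, 0 ≤ T → ∫ v, f v T * expTaylor n (a * ‖v‖ ^ 2) ≤ m₀ := by
    intro n hn T hT
    obtain ⟨N, hN⟩ := exists_moment_bound hd H hβ hβ1 hf hc hpoly n T
    have hweak : ∀ s t, 0 ≤ s → s ≤ t → t ≤ T → _ := fun s t hs hst htT =>
      hf.integral_sub_eq hd H hβ hβ1 hs hst (fun τ hτ => hN τ ⟨hs.trans hτ.1, hτ.2.trans htT⟩)
        (measurable_expTaylor_norm n a) (expTaylor_nonneg n ha0.le)
        (fun v => expTaylor_mul_le n ha0.le (sq_nonneg _))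
    refine barrier hm₀ (hweak 0 T le_rfl hT le_rfl).1
      (fun s t hs hst htT => (hweak s t hs hst htT).2) (fun τ hτ hF1 hF2 => ?_) (hinit n) hT
    have hnn := hf.nonneg τ hτ.1
    have hmom := (hN τ hτ).1
    have hmeas := hf.measurable_section τ
    have hineq := integral_expTaylor_collision_le hd H hA hβ hβ1 hmeas hnn
      ha0.le hmom (hL a ha0 ha1 n hn)
    have iρ : Integrable (fun v => f v τ * ‖v‖ ^ β) :=
      integrable_mul_of_moment hmeas (moment_one hf hc hτ.1).1 (by fun_prop) (C := 1) fun v => by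
        rw [abs_of_nonneg (by positivity), one_mul, zero_add, pow_one]
        exact norm_rpow_le hβ hβ1 v
    have hψm := measurable_expTaylor_norm (d := d) n a
    have iρψ : Integrable (fun v => f v τ * (‖v‖ ^ β * expTaylor n (a * ‖v‖ ^ 2))) :=
      integrable_mul_of_moment hmeas hmom (by fun_prop) (C := expTaylor n a) fun v => by
        rw [abs_mul, abs_of_nonneg (by positivity : 0 ≤ ‖v‖ ^ β)]
        calc ‖v‖ ^ β * |expTaylor n (a * ‖v‖ ^ 2)|
            ≤ (1 + ‖v‖ ^ 2) * (expTaylor n a * (1 + ‖v‖ ^ 2) ^ n) :=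
              mul_le_mul (norm_rpow_le hβ hβ1 v) (expTaylor_mul_le n ha0.le (sq_nonneg _))
                (abs_nonneg _) (by positivity)
          _ = _ := by ring
    rw [(hc.mass τ hτ.1).2, (hc.energy τ hτ.1).2] at hineq
    set F := ∫ v, f v τ * expTaylor n (a * ‖v‖ ^ 2) with hF
    set J := ∫ v, f v τ * (‖v‖ ^ β * expTaylor n (a * ‖v‖ ^ 2)) with hJ
    set mβ := ∫ v, f v τ * ‖v‖ ^ β with hmβ
    have hmβ0 : 0 ≤ mβ := by
      refine integral_nonneg_of_ae ?_
      filter_upwards [hnn] with v hv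
      exact mul_nonneg hv (by positivity)
    have hmβ1 : mβ ≤ m₀ + m₁ := by
      rw [hm₁, hm₀', ← (hc.mass τ hτ.1).2, ← (hc.energy τ hτ.1).2,
        ← integral_add (hc.mass τ hτ.1).1 (hc.energy τ hτ.1).1]
      refine integral_mono_ae iρ ((hc.mass τ hτ.1).1.add (hc.energy τ hτ.1).1) ?_
      filter_upwards [hnn] with v hv
      calc f v τ * ‖v‖ ^ β ≤ f v τ * (1 + ‖v‖ ^ 2) := by
            gcongr; exact norm_rpow_le hβ hβ1 v
        _ = _ := by ring
    have hRp : 0 < R ^ β := by positivity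
    -- For |v| ≥ R the factor |v|^β is at least R^β; for |v| ≤ R the weight is at most 1/2, so the
    -- left integrand is nonpositive.
    have hJ1 : R ^ β * (F - 1 / 2 * m₀) ≤ J := by
      rw [hm₀', ← (hc.mass τ hτ.1).2, ← integral_const_mul, hF,
        ← integral_sub (hψle n τ hτ.1) ((hc.mass τ hτ.1).1.const_mul _), ← integral_const_mul]
      refine integral_mono_ae (((hψle n τ hτ.1).sub
        ((hc.mass τ hτ.1).1.const_mul _)).const_mul _) iρψ ?_
      filter_upwards [hnn] with v hv
      have hψ0 : 0 ≤ expTaylor n (a * ‖v‖ ^ 2) := expTaylor_nonneg n (by positivity)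
      have hpt : R ^ β * (expTaylor n (a * ‖v‖ ^ 2) - 1 / 2)
          ≤ ‖v‖ ^ β * expTaylor n (a * ‖v‖ ^ 2) := by
        rcases le_total R ‖v‖ with h1 | h1
        · have : R ^ β ≤ ‖v‖ ^ β := Real.rpow_le_rpow (by linarith) h1 hβ.le
          nlinarith
        · have h2 : expTaylor n (a * ‖v‖ ^ 2) ≤ 1 / 2 := by
            have h3 := one_add_expTaylor_le_exp n (by positivity : 0 ≤ a * ‖v‖ ^ 2)
            have h4 : a * ‖v‖ ^ 2 ≤ Real.log (3 / 2) := le_trans (by gcongr) haR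
            have h5 := Real.exp_le_exp.2 h4
            rw [Real.exp_log (by norm_num)] at h5
            linarith
          have h6 : R ^ β * (expTaylor n (a * ‖v‖ ^ 2) - 1 / 2) ≤ 0 :=
            mul_nonpos_of_nonneg_of_nonpos hRp.le (by linarith)
          exact h6.trans (by positivity)
      calc R ^ β * (f v τ * expTaylor n (a * ‖v‖ ^ 2) - 1 / 2 * f v τ)
          = f v τ * (R ^ β * (expTaylor n (a * ‖v‖ ^ 2) - 1 / 2)) := by ring
        _ ≤ _ := by gcongr
    have hJ2 : R ^ β * (1 / 2 * m₀) ≤ J := le_trans (by gcongr; linarith) hJ1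
    have hJ0 : 0 ≤ J := le_trans (by positivity) hJ2
    refine hineq.trans ?_
    -- With F ≤ 2m₀, m₀ + F ≤ 3m₀ turns A/6 into A/2, so half of the loss A m₀ J survives.
    have k1 : (mβ + J) * (m₀ + F) ≤ (mβ + J) * (3 * m₀) := by gcongr; linarith
    have k2 : F * mβ ≤ 2 * m₀ * mβ := by gcongr
    have k3 : m₀ * (A * mβ) ≤ m₀ * (A * (m₀ + m₁)) := by gcongr
    have k4 : A * m₀ * (R ^ β * (1 / 2 * m₀)) ≤ A * m₀ * J := by gcongr
    have k5 := mul_le_mul_of_nonneg_left hR hm₀.le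
    have k6 := mul_le_mul_of_nonneg_left k1 hA.le
    have k7 := mul_le_mul_of_nonneg_left k2 hA.le
    linarith
  refine ⟨a, ha0, fun t ht => ?_⟩
  refine fatou_bound (F := fun n v => f v t * (1 + expTaylor n (a * ‖v‖ ^ 2))) (fun n => ?_)
    (fun n => ?_) ?_ (.of_forall fun v => (tendsto_one_add_expTaylor _).const_mul _)
  · refine ((hc.mass t ht).1.add (hψle n t ht)).congr (.of_forall fun v => ?_)
    simp [mul_add]
  · filter_upwards [hf.nonneg t ht] with v hv
    exact mul_nonneg hv (by have := expTaylor_nonneg n (by positivity : 0 ≤ a * ‖v‖ ^ 2); linarith)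
  · filter_upwards [eventually_ge_atTop m] with n hn
    simp only [mul_add, mul_one]
    rw [integral_add (hc.mass t ht).1 (hψle n t ht), (hc.mass t ht).2]
    linarith [hbound n hn t ht]

/-- Without collisions the solution is constant in time. -/
theorem ae_eq_initial_of_mass_zero (H : IsAngularKernel d h 0) (hβ : 0 < β)
    (hf : IsMildSolution (kernel β h) f₀ f) {t : ℝ} (ht : 0 ≤ t) : ∀ᵐ v, f v t = f v 0 := by
  have hcol : ∀ g v, collision (kernel β h) g v = (0 : ℝ) := fun (g : V d → ℝ) v => by
    simp only [collision]
    have : ∀ w, ∫ σ, (g (vPrimeStar v w σ) * g (vPrime v w σ) - g w * g v)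
        * kernel β h (v - w) σ ∂(surface d) = 0 := fun w => by
      have h1 := (integral_eq_zero_iff_of_nonneg (fun σ => H.kernel_nonneg (v - w) σ)
        (H.integrable_kernel hβ (v - w))).1 (by rw [H.integral_kernel hβ, zero_mul])
      refine integral_eq_zero_of_ae ?_
      filter_upwards [h1] with σ hσ
      simp only [Pi.zero_apply] at hσ ⊢
      rw [hσ, mul_zero]
    simp [this]
  rcases ht.eq_or_lt with rfl | hlt
  · exact .of_forall fun _ => rfl
  · filter_upwards [hf.mild] with v hv
    have := (hv.2 0 t le_rfl hlt).2
    simp only [hcol, intervalIntegral.integral_zero] at this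
    linarith

theorem div_maxwellian (a y : ℝ) (v : V d) : y / maxwellian a v = y * Real.exp (a * ‖v‖ ^ 2) := by
  rw [maxwellian, neg_mul, Real.exp_neg, div_inv_eq_mul]

end

end Boltzmann

end

/-! ### Conclusion, with the degenerate cases -/

theorem theorem4 (d : ℕ) (hd : 2 ≤ d) (β : ℝ) (h : ℝ → ℝ)
    (hB : Boltzmann.IsHardPotentialCutoff d β h)
    (f₀ : Boltzmann.V d → ℝ) (hf₀ : ∀ᵐ v, 0 ≤ f₀ v)
    (a₀ : ℝ) (ha₀ : 0 < a₀)
    (hM₀ : MeasureTheory.Integrable (fun v => f₀ v / Boltzmann.maxwellian a₀ v))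
    (f : Boltzmann.V d → ℝ → ℝ)
    (hf : Boltzmann.IsMildSolution (Boltzmann.kernel β h) f₀ f)
    (hcons : Boltzmann.ConservesMassEnergy f₀ f) :
    ∃ C a : ℝ, 0 < a ∧ ∀ t : ℝ, 0 ≤ t →
      MeasureTheory.Integrable (fun v => f v t / Boltzmann.maxwellian a v) ∧
      ∫ v, f v t / Boltzmann.maxwellian a v ≤ C := by
  obtain ⟨A, H⟩ := hB.exists_isAngularKernel hd
  have hβ := hB.beta_pos
  have hf' : Boltzmann.IsMildSolution
      (Boltzmann.kernel β ((Ioo (-1 : ℝ) 1).indicator h)) f₀ f := by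
    refine ⟨hf.measurable, hf.nonneg, hf.integrable, hf.continuous_L1, hf.bounded, ?_⟩
    rw [← Boltzmann.collision_indicator hd hβ h]
    exact hf.mild
  simp only [Boltzmann.div_maxwellian] at hM₀ ⊢
  have hinit : (fun v => f v 0 * Real.exp (a₀ * ‖v‖ ^ 2)) =ᵐ[volume]
      fun v => f₀ v * Real.exp (a₀ * ‖v‖ ^ 2) := by
    filter_upwards [hf.mild] with v hv
    rw [hv.1]
  have hexp := hM₀.congr hinit.symm
  -- The main argument divides by A m₀. If A = 0 the solution does not evolve; if m₀ = 0 it vanishes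
  -- almost everywhere. In both cases a₀ itself works.
  rcases (H.mass_nonneg hd).eq_or_lt with hA | hA
  · subst hA
    refine ⟨∫ v, f v 0 * Real.exp (a₀ * ‖v‖ ^ 2), a₀, ha₀, fun t ht => ?_⟩
    have e : (fun v => f v t * Real.exp (a₀ * ‖v‖ ^ 2)) =ᵐ[volume]
        fun v => f v 0 * Real.exp (a₀ * ‖v‖ ^ 2) := by
      filter_upwards [Boltzmann.ae_eq_initial_of_mass_zero H hβ hf' ht] with v hv
      rw [hv]
    exact ⟨hexp.congr e.symm, (integral_congr_ae e).le⟩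
  rcases (Boltzmann.mass_nonneg hf' hcons).eq_or_lt with hm | hm
  · refine ⟨0, a₀, ha₀, fun t ht => ?_⟩
    have h0 := (integral_eq_zero_iff_of_nonneg_ae (hf.nonneg t ht) (hcons.mass t ht).1).1
      ((hcons.mass t ht).2.trans hm.symm)
    have e : (fun v => f v t * Real.exp (a₀ * ‖v‖ ^ 2)) =ᵐ[volume] fun _ => (0 : ℝ) := by
      filter_upwards [h0] with v hv
      rw [hv]; simp
    exact ⟨(integrable_zero _ _ _).congr e.symm, by rw [integral_congr_ae e]; simp⟩
  · obtain ⟨a, ha, hbound⟩ := Boltzmann.exists_exponential_moment_bound hd H hA hβ hB.beta_le_one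
      hf' hcons hm ha₀ hexp
    exact ⟨_, a, ha, hbound⟩
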